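/- **Model.** Let $m\ge 2$, $n$, $L$, $n_0\ge 0$ and $s$ be integers. A dynamic stochastic block model consists of a connectivity tensor $G\in[0,1]^{m\times m\times L}$, symmetric in the sense that $G_{k,k',l}=G_{k',k,l}$, and of class assignments $z_l:\{1,\dots,n\}\to\{1,\dots,m\}$, $l=1,\dots,L$. The connection probabilities are $\Lambda_{i,j,l}=G_{z_l(i),z_l(j),l}$ for $i\neq j$, and $\Lambda_{i,i,l}=0$. One observes independent Bernoulli variables $B_{i,j,l}$, $1\le i<j\le n$, $1\le l\le L$, with $\mathbb P(B_{i,j,l}=1)=\Lambda_{i,j,l}$; $\mathbb P_\Lambda$ is their joint law. Put $M=m(m+1)/2$, let $Q\in\mathbb R^{M\times L}$ be the matrix with entries $G_{k,k',l}$, rows being indexed by the pairs $k\le k'$ and columns by $l$, and let $q=\mathrm{vec}(Q)$. For an orthogonal matrix $H\in\mathbb R^{L\times L}$ put $W=H\otimes I_M$, and let $\mathcal G_{m,L,s}$ be the set of connectivity tensors $G$ for which $q=W^Td$ for some $d\in\mathbb R^{ML}$ with at most $s$ nonzero components. Let $\mathcal Z(m,n,n_0,L)$ be the set of sequences $z=(z_1,\dots,z_L)$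 such that $z_l(i)\neq z_{l+1}(i)$ for at most $n_0$ nodes $i$, for each $l=1,\dots,L-1$. Let $\|\cdot\|$ be the Frobenius norm on $\mathbb R^{n\times n\times L}$. **Theorem.** There is a function $C:(0,\infty)\to(0,\infty)$ such that the following holds for every $\kappa>0$, with $\gamma=\min(\kappa,1/2)$. Let $H\in\mathbb R^{L\times L}$ be orthogonal with $$\|H^T\omega\|_\infty\le \|\omega\|_1/\sqrt L\ \text{ for all }\omega\in\{0,1\}^L,\qquad H\mathbf 1=\sqrt L\,e_1 .$$ Assume that $L\ge2$, $n\ge 2m$, $s\ge\kappa m^2$, $m\ge 2$, $s\ge 2$ and $(m,s)\ne(2,2)$, and that $$n_0\le\min\left(\gamma n,\ \tfrac43\gamma\, n\, m^{-1/9}\right),\qquad s^2\log(2LM/s)\le 68\,LMn^2 .$$ Then $$\inf_{\hat\Lambda}\ \sup_{G\in\mathcal G_{m,L,s},\ z\in\mathcal Z(m,n,n_0,L)}\ \mathbb P_\Lambda\left\{\frac{\|\hat\Lambda-\Lambda\|^2}{n^2L}\ \ge\ C(\gamma)\left(\frac{\log m}{nL}+\frac{n_0}{n^2}\log\frac{mne}{n_0}+\frac{s\log(Lm^2/s)}{n^2L}\right)\right\}\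 \ge\ \frac14,$$ where the infimum is over all estimators $\hat\Lambda$ of $\Lambda$, i.e. all $\mathbb R^{n\times n\times L}$-valued functions of the observations, and the second term is read as $0$ if $n_0=0$. -/

import Mathlib

open MeasureTheory ProbabilityTheory unitInterval
open scoped ENNReal Matrix Kronecker

noncomputable section

namespace DSBM

/-- Unordered pairs of distinct nodes, written as `(i, j)` with `i < j`: the independent entries of
a symmetric adjacency matrix with zero diagonal. There are `n (n - 1) / 2` of them. -/
abbrev NodePair (n : ℕ) : Type := {p : Fin n × Fin n // p.1 < p.2}

/-- Unordered pairs of classes, written as `(k, k')` with `k ≤ k'`: the non-redundant entries of a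
symmetric `m × m` matrix. There are `m (m + 1) / 2` of them. -/
abbrev ClassPair (m : ℕ) : Type := {p : Fin m × Fin m // p.1 ≤ p.2}

/-- Tensors with entries in `[0, 1]`, as functions of two indices and of the time. -/
abbrev ProbTensor (n L : ℕ) : Type := Fin n → Fin n → Fin L → I

/-- The connectivity tensor `G` is symmetric in its two class indices. -/
def IsConnectivity {m L : ℕ} (G : ProbTensor m L) : Prop :=
  ∀ k k' l, G k k' l = G k' k l

/-- The matrix `Q` with one row for each unordered pair of classes and one column for each
time; its columns are the vectors `q^(l)`. -/
def connMatrix {m L : ℕ} (G : ProbTensor m L) : Matrix (ClassPair m) (Fin L) ℝ :=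
  Matrix.of fun p l => (G p.1.1 p.1.2 l : ℝ)

/-- The orthogonal matrix `W = H ⊗ I_M` acting on the vectorized matrix `q = vec Q`. -/
def transformW (m : ℕ) {L : ℕ} (H : Matrix (Fin L) (Fin L) ℝ) :
    Matrix (Fin L × ClassPair m) (Fin L × ClassPair m) ℝ :=
  H ⊗ₖ (1 : Matrix (ClassPair m) (ClassPair m) ℝ)

/-- The connectivity tensors whose vectorized version `q` is `Wᵀ d` for a vector `d` that has at
most `s` nonzero components. -/
def sparseTensors (m L s : ℕ) (H : Matrix (Fin L) (Fin L) ℝ) : Set (ProbTensor m L) :=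
  {G | IsConnectivity G ∧ ∃ d : Fin L × ClassPair m → ℝ,
    (connMatrix G).vec = (transformW m H)ᵀ *ᵥ d ∧ {x | d x ≠ 0}.ncard ≤ s}

/-- The sequences of clusterings of `n` nodes into `m` classes (`z l i` is the class of node `i`
at time `l`) such that at most `n₀` nodes change class between two consecutive times. -/
def clusterings (m n n₀ L : ℕ) : Set (Fin L → Fin n → Fin m) :=
  {z | ∀ l l' : Fin L, (l' : ℕ) = l + 1 → {i | z l' i ≠ z l i}.ncard ≤ n₀}

/-- The tensor of connection probabilities: zero on the diagonal `i = j`, and otherwise determined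
by the classes of the two nodes at time `l`. -/
def connProb {m n L : ℕ} (G : ProbTensor m L) (z : Fin L → Fin n → Fin m) : ProbTensor n L :=
  fun i j l => if i = j then 0 else G (z l i) (z l j) l

/-- The observed network: for each pair of nodes and each time, whether there is an edge. The
remaining entries of the adjacency tensor are determined by symmetry and the zero diagonal. -/
abbrev Observation (n L : ℕ) : Type := NodePair n × Fin L → Bool

/-- The law of the observed network: the edges are independent Bernoulli variables with the
success probabilities given by the tensor. -/
def law {n L : ℕ} (Lam : ProbTensor n L) : Measure (Observation n L) :=
  Measure.pi fun e => bernoulliMeasure true false (Lam e.1.1.1 e.1.1.2 e.2)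

/-- The squared Frobenius distance between a real tensor and a tensor of probabilities. -/
def sqDist {n L : ℕ} (T : Fin n → Fin n → Fin L → ℝ) (Lam : ProbTensor n L) : ℝ :=
  ∑ i, ∑ j, ∑ l, (T i j l - (Lam i j l : ℝ)) ^ 2

/-- The two conditions on the transform: `‖Hᵀ ω‖_∞ ≤ ‖ω‖₁ / √L` for all binary vectors `ω`, and
`H 1 = √L e₁`. -/
def TransformCondition {L : ℕ} (H : Matrix (Fin L) (Fin L) ℝ) : Prop :=
  (∀ ω : Fin L → ℝ, (∀ l, ω l = 0 ∨ ω l = 1) →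
    ∀ j, |(Hᵀ *ᵥ ω) j| ≤ (∑ l, |ω l|) / √(L : ℝ)) ∧
  H *ᵥ (fun _ => 1) = fun l : Fin L => if (l : ℕ) = 0 then √(L : ℝ) else 0

/-- The rate in the lower bound. -/
def rate (m n L n₀ s : ℕ) : ℝ :=
  Real.log m / (n * L) + (n₀ : ℝ) / (n : ℝ) ^ 2 * Real.log (m * n * Real.exp 1 / n₀) +
    s * Real.log (L * (m : ℝ) ^ 2 / s) / ((n : ℝ) ^ 2 * L)

end DSBM

end

/-! ### Assouad's lemma over a finite alphabet -/

namespace DSBM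

/-! The bound comes from an Assouad argument over a finite alphabet `A`. Hypotheses are indexed by
words `θ : B → A`, and squared distances between their tensors are at least `r` times the Hamming
distance. If resetting one letter to a reference `a₀` costs a squared distance of at most `log |A| /
600`, then that letter cannot be recovered reliably even when all the others are known: the
chi-square affinity with the reference is at most `|A| ^ (1 / 100)`. Averaging over words, for some
word at least a twentieth of the letters is wrong with probability at least `1 / 4`. Rounding an
estimator to the nearest hypothesis gives a loss of at least `r |B| / 80`
(`DSBM.exists_quarter_le_law`). With `r` of order `log |A|`, the unnormalized bound is of order `|B|
log |A|`, and this already works for `|A| = 2`.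

Each term of the rate has its own product family. For `log m / (nL)`, the connectivity is a fixed
sparse pattern that is constant in time, and each of `n / 2` nodes chooses one of `K + 1` classes
once for all times. The classes are told apart by their connections to the other half of the nodes,
through a Hadamard code. The lower bound on `s` makes `K + 1` comparable to `m`
(`Pattern.exists_of_sparsity`). For the `n₀` term, at each even time `n₀` disjoint blocks of about
`n / (2 n₀)` nodes each move at most one node to one of `K` other classes, and at odd times
everything returns to rest. Here `|B|` is about `L n₀ / 2` and `|A|` is of order `mn / n₀` up to a
factor depending on `γ`. For the sparsity term, the clustering is balanced and fixed. On a set `P`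
of class pairs each row of `Q` is `1 / 2` plus a perturbation whose transform has at most one
nonzero coefficient in each of `t` blocks (`exists_quarter_le_law_sparse`). If `s` is so large that
all entries on `P` can be free, independent bits are used instead (`exists_quarter_le_law_dense`).

The rate is at most three times its largest term, so treating whichever term is largest suffices. -/

lemma hammingDist_update_le_one {A B : Type*} [Fintype B] [DecidableEq A] [DecidableEq B]
    (θ : B → A) (b : B) (a : A) : hammingDist θ (Function.update θ b a) ≤ 1 := by
  have h : ∀ i, θ i ≠ Function.update θ b a i → i = b := fun i hi => by
    by_contra hib
    exact hi (by rw [Function.update_of_ne hib])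
  refine Finset.card_le_one.2 fun i hi j hj => ?_
  rw [h i (by simpa using hi), h j (by simpa using hj)]

/-- Re-choosing one coordinate of a function: summing over the function and the new value counts
every function `card A` times. -/
lemma sum_sum_update {A B : Type*} [Fintype A] [Fintype B] [DecidableEq A] [DecidableEq B] (b : B)
    (F : (B → A) → ℝ) :
    ∑ θ : B → A, ∑ a, F (Function.update θ b a) = Fintype.card A * ∑ θ, F θ := by
  have e : Function.Involutive
      (fun x : (B → A) × A => ((Function.update x.1 b x.2, x.1 b) : (B → A) × A)) := by
    rintro ⟨θ, a⟩
    simp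
  have h := Equiv.sum_comp e.toPerm (fun x : (B → A) × A => F x.1)
  simp only [Fintype.sum_prod_type, Function.Involutive.coe_toPerm] at h
  rw [h]
  simp [Finset.mul_sum]

/-- The total success probability of a test between finitely many probability vectors, in terms of
their likelihood ratios with respect to a reference vector. -/
lemma sum_success_le {A Ω : Type*} [Fintype A] [Fintype Ω] [DecidableEq A] (p : A → Ω → ℝ)
    (q : Ω → ℝ) (hq : ∀ ω, 0 ≤ q ω) (hq1 : ∑ ω, q ω = 1)
    (hac : ∀ a ω, q ω = 0 → p a ω = 0) {V : ℝ} (hV : ∀ a, ∑ ω, p a ω ^ 2 / q ω ≤ V) (d : Ω → A) :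
    ∑ ω, p (d ω) ω ≤ √(Fintype.card A * V) := by
  have h1 : ∑ ω, p (d ω) ω ^ 2 / q ω ≤ Fintype.card A * V := by
    -- The selected hypothesis depends on `ω`; the sum over all hypotheses removes this dependence
    -- at the price of the factor `card A`.
    calc ∑ ω, p (d ω) ω ^ 2 / q ω ≤ ∑ ω, ∑ a, p a ω ^ 2 / q ω :=
          Finset.sum_le_sum fun ω _ => Finset.single_le_sum (f := fun a => p a ω ^ 2 / q ω)
            (fun a _ => div_nonneg (sq_nonneg _) (hq ω)) (Finset.mem_univ _)
      _ = ∑ a, ∑ ω, p a ω ^ 2 / q ω := Finset.sum_comm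
      _ ≤ ∑ _a : A, V := Finset.sum_le_sum fun a _ => hV a
      _ = _ := by simp
  refine Real.le_sqrt_of_sq_le (le_trans ?_ h1)
  -- Cauchy–Schwarz with `p = √(p² / q) · √q`; absolute continuity covers the points with `q ω = 0`.
  have h2 := Finset.sum_sq_le_sum_mul_sum_of_sq_le_mul Finset.univ (r := fun ω => p (d ω) ω)
    (f := fun ω => p (d ω) ω ^ 2 / q ω) (g := q)
    (fun ω _ => div_nonneg (sq_nonneg _) (hq ω)) (fun ω _ => hq ω) (fun ω _ => by
      by_cases h : q ω = 0
      · simp [h, hac _ _ h]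
      · rw [div_mul_cancel₀ _ h])
  rwa [hq1, mul_one] at h2

/-- A form of Assouad's lemma: in a product family of probability vectors, for every decision rule
some parameter has a small expected number of correctly decided coordinates. -/
lemma exists_sum_card_eq_le {A B Ω : Type*} [Fintype A] [Fintype B] [Fintype Ω] [DecidableEq A]
    [DecidableEq B] (a₀ : A) (f : (B → A) → Ω → ℝ) (hf : ∀ θ ω, 0 ≤ f θ ω)
    (hf1 : ∀ θ, ∑ ω, f θ ω = 1)
    (hac : ∀ θ b ω, f (Function.update θ b a₀) ω = 0 → f θ ω = 0) {V ρ : ℝ} (hρ : 0 ≤ ρ)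
    (hV : ∀ θ b, ∑ ω, f θ ω ^ 2 / f (Function.update θ b a₀) ω ≤ V)
    (hVρ : V ≤ ρ ^ 2 * Fintype.card A) (d : Ω → B → A) :
    ∃ θ, ∑ ω, f θ ω * (Finset.univ.filter fun b => d ω b = θ b).card ≤ ρ * Fintype.card B := by
  have hN : (0 : ℝ) < Fintype.card A := by exact_mod_cast Fintype.card_pos_iff.2 ⟨a₀⟩
  have hS : ∀ b, ∑ θ, ∑ ω, f θ ω * (if d ω b = θ b then 1 else 0) ≤
      Fintype.card (B → A) * ρ := by
    intro b
    -- For a uniform word, coordinate `b` can be redrawn. With the other coordinates fixed this is a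
    -- test between `card A` hypotheses, with the word reset to `a₀` at `b` as reference.
    have h1 := sum_sum_update b (fun θ => ∑ ω, f θ ω * (if d ω b = θ b then 1 else 0))
    have h2 : ∀ θ, ∑ a, ∑ ω, f (Function.update θ b a) ω *
        (if d ω b = Function.update θ b a b then 1 else 0) ≤ Fintype.card A * ρ := by
      intro θ
      rw [Finset.sum_comm]
      simp only [Function.update_self, mul_ite, mul_one, mul_zero, Finset.sum_ite_eq,
        Finset.mem_univ, if_true]
      refine (sum_success_le (fun a => f (Function.update θ b a)) (f (Function.update θ b a₀))
        (hf _) (hf1 _) (fun a ω h => hac _ b ω (by simpa using h)) (V := V)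
        (fun a => by simpa using hV (Function.update θ b a) b) (fun ω => d ω b)).trans ?_
      rw [Real.sqrt_le_left (by positivity)]
      nlinarith
    have h3 : ∑ θ : B → A, ∑ a, ∑ ω, f (Function.update θ b a) ω *
        (if d ω b = Function.update θ b a b then 1 else 0) ≤
        Fintype.card (B → A) * (Fintype.card A * ρ) :=
      (Finset.sum_le_sum fun θ _ => h2 θ).trans (by simp)
    rw [h1] at h3
    exact le_of_mul_le_mul_left (by linarith) hN
  by_contra! hcon
  have h4 : ∑ θ : B → A, ρ * Fintype.card B <
      ∑ θ, ∑ ω, f θ ω * (Finset.univ.filter fun b => d ω b = θ b).card :=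
    Finset.sum_lt_sum_of_nonempty ⟨fun _ => a₀, Finset.mem_univ _⟩ fun θ _ => hcon θ
  have h5 : ∑ θ, ∑ ω, f θ ω * (Finset.univ.filter fun b => d ω b = θ b).card =
      ∑ b, ∑ θ, ∑ ω, f θ ω * (if d ω b = θ b then 1 else 0) := by
    conv_rhs => rw [Finset.sum_comm]
    refine Finset.sum_congr rfl fun θ _ => ?_
    conv_rhs => rw [Finset.sum_comm]
    refine Finset.sum_congr rfl fun ω _ => ?_
    rw [← Finset.mul_sum]
    simp
  have h6 : ∑ b, ∑ θ, ∑ ω, f θ ω * (if d ω b = θ b then 1 else 0) ≤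
      Fintype.card B * (Fintype.card (B → A) * ρ) :=
    (Finset.sum_le_sum fun b _ => hS b).trans (by simp)
  have h7 : ∑ θ : B → A, ρ * Fintype.card B = Fintype.card (B → A) * (ρ * Fintype.card B) := by
    simp
  linarith [mul_left_comm (Fintype.card B : ℝ) (Fintype.card (B → A) : ℝ) ρ]

/-- Assouad's lemma in probability. -/
lemma exists_quarter_le_sum_hammingDist {A B Ω : Type*} [Fintype A] [Fintype B] [Fintype Ω]
    [DecidableEq A] [DecidableEq B] [Nonempty B] (a₀ : A) (f : (B → A) → Ω → ℝ)
    (hf : ∀ θ ω, 0 ≤ f θ ω) (hf1 : ∀ θ, ∑ ω, f θ ω = 1)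
    (hac : ∀ θ b ω, f (Function.update θ b a₀) ω = 0 → f θ ω = 0) {V : ℝ}
    (hV : ∀ θ b, ∑ ω, f θ ω ^ 2 / f (Function.update θ b a₀) ω ≤ V)
    (hVN : V ≤ 0.7125 ^ 2 * Fintype.card A) (d : Ω → B → A) :
    ∃ θ, 1 / 4 ≤ ∑ ω with (Fintype.card B : ℝ) / 20 ≤ hammingDist (d ω) θ, f θ ω := by
  obtain ⟨θ, hθ⟩ := exists_sum_card_eq_le a₀ f hf hf1 hac (by norm_num) hV hVN d
  refine ⟨θ, ?_⟩
  have hB : (0 : ℝ) < Fintype.card B := by exact_mod_cast Fintype.card_pos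
  have hsplit := Finset.sum_filter_add_sum_filter_not Finset.univ
    (fun ω => (Fintype.card B : ℝ) / 20 ≤ hammingDist (d ω) θ) (f θ)
  rw [hf1] at hsplit
  -- Fewer than `1 / 20` errors means more than `0.95 * card B` correct coordinates, and `0.7125 =
  -- 0.95 * 0.75`, so Markov's inequality leaves probability at most `3 / 4`.
  have hmarkov : (∑ ω with ¬ ((Fintype.card B : ℝ) / 20 ≤ hammingDist (d ω) θ), f θ ω) *
      (0.95 * Fintype.card B) ≤ 0.7125 * Fintype.card B := by
    refine le_trans ?_ hθ
    rw [Finset.sum_mul]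
    refine (Finset.sum_le_sum fun ω hω => ?_).trans (Finset.sum_le_sum_of_subset_of_nonneg
      (Finset.subset_univ _) fun ω _ _ => mul_nonneg (hf _ _) (Nat.cast_nonneg _))
    refine mul_le_mul_of_nonneg_left ?_ (hf _ _)
    have h1 : (Finset.univ.filter fun b => d ω b = θ b).card + hammingDist (d ω) θ =
        Fintype.card B := by
      rw [hammingDist, Finset.card_filter_add_card_filter_not, Finset.card_univ]
    have h2 : ((Finset.univ.filter fun b => d ω b = θ b).card : ℝ) + hammingDist (d ω) θ =
        Fintype.card B := by exact_mod_cast h1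
    have h3 := (Finset.mem_filter.1 hω).2
    push Not at h3
    linarith
  have h4 : ∑ ω with ¬ ((Fintype.card B : ℝ) / 20 ≤ hammingDist (d ω) θ), f θ ω ≤ 3 / 4 := by
    by_contra h
    rw [not_le] at h
    nlinarith
  linarith

end DSBM

/-! ### Likelihoods of Bernoulli networks and reduction of estimation to testing -/

namespace DSBM

/-- The Bernoulli probability vector with success probability `p`. -/
def bernoulliWeight (p : ℝ) (x : Bool) : ℝ := if x then p else 1 - p

/-- The probability of an observation under the law with the given connection probabilities. -/
def obsWeight {n L : ℕ} (Lam : ProbTensor n L) (a : Observation n L) : ℝ :=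
  ∏ e, bernoulliWeight (Lam e.1.1.1 e.1.1.2 e.2) (a e)

lemma bernoulliWeight_nonneg (p : I) (x : Bool) : 0 ≤ bernoulliWeight p x := by
  unfold bernoulliWeight
  split_ifs
  · exact p.2.1
  · linarith [p.2.2]

lemma obsWeight_nonneg {n L : ℕ} (Lam : ProbTensor n L) (a : Observation n L) :
    0 ≤ obsWeight Lam a :=
  Finset.prod_nonneg fun _ _ => bernoulliWeight_nonneg _ _

lemma sum_obsWeight {n L : ℕ} (Lam : ProbTensor n L) : ∑ a, obsWeight Lam a = 1 := by
  unfold obsWeight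
  rw [← Fintype.prod_sum (fun (e : NodePair n × Fin L) x =>
    bernoulliWeight (Lam e.1.1.1 e.1.1.2 e.2) x)]
  simp [bernoulliWeight]

lemma law_apply {n L : ℕ} (Lam : ProbTensor n L) (S : Set (Observation n L))
    [DecidablePred (· ∈ S)] : law Lam S = ENNReal.ofReal (∑ a with a ∈ S, obsWeight Lam a) := by
  have h1 : ∀ a, law Lam {a} = ENNReal.ofReal (obsWeight Lam a) := by
    intro a
    unfold law obsWeight
    rw [Measure.pi_singleton, ENNReal.ofReal_prod_of_nonneg fun _ _ => bernoulliWeight_nonneg _ _]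
    refine Finset.prod_congr rfl fun e _ => ?_
    rw [← ofReal_measureReal, bernoulliMeasure_real_apply _ (MeasurableSet.singleton _)]
    cases a e <;> simp [bernoulliWeight]
  have h2 : S = ((Finset.univ.filter (· ∈ S) : Finset (Observation n L)) : Set _) := by
    ext; simp
  conv_lhs => rw [h2]
  rw [← sum_measure_singleton, ENNReal.ofReal_sum_of_nonneg fun a _ => obsWeight_nonneg _ _]
  exact Finset.sum_congr rfl fun a _ => h1 a

/-- The sum is `1 + (p - q)² / (q (1 - q))`, and `q (1 - q) ≥ 3 / 16 ≥ 1 / 6` on the interval. Equal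
parameters are allowed anywhere, so entries with probability `0` outside the support of a
connectivity do no harm. -/
lemma sum_sq_bernoulliWeight_div_le {p q : ℝ} (h : p = q ∨ q ∈ Set.Icc (1 / 4) (3 / 4)) :
    ∑ x, bernoulliWeight p x ^ 2 / bernoulliWeight q x ≤ Real.exp (6 * (p - q) ^ 2) := by
  rcases h with rfl | ⟨h1, h2⟩
  · have : ∀ x : ℝ, x ^ 2 / x = x := fun x => by
      rcases eq_or_ne x 0 with rfl | hx
      · simp
      · field_simp
    simp [bernoulliWeight, this]
  · have h3 : ∑ x, bernoulliWeight p x ^ 2 / bernoulliWeight q x =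
        1 + (p - q) ^ 2 / (q * (1 - q)) := by
      have : 1 - q ≠ 0 := by linarith
      have : q ≠ 0 := by linarith
      simp only [Fintype.sum_bool, bernoulliWeight, if_true, Bool.false_eq_true, if_false]
      field_simp
      ring
    have h4 : (p - q) ^ 2 / (q * (1 - q)) ≤ 6 * (p - q) ^ 2 := by
      rw [div_le_iff₀ (by nlinarith)]
      nlinarith [mul_nonneg (sq_nonneg (p - q)) (by nlinarith : 0 ≤ 6 * (q * (1 - q)) - 1)]
    rw [h3]
    linarith [Real.add_one_le_exp (6 * (p - q) ^ 2)]

lemma sum_edges_le_sqDist {n L : ℕ} (Lam Lam' : ProbTensor n L) :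
    ∑ e : NodePair n × Fin L,
      ((Lam e.1.1.1 e.1.1.2 e.2 : ℝ) - Lam' e.1.1.1 e.1.1.2 e.2) ^ 2 ≤
    sqDist (fun i j l => (Lam i j l : ℝ)) Lam' := by
  have h1 : sqDist (fun i j l => (Lam i j l : ℝ)) Lam' =
      ∑ e : (Fin n × Fin n) × Fin L, ((Lam e.1.1 e.1.2 e.2 : ℝ) - Lam' e.1.1 e.1.2 e.2) ^ 2 := by
    simp only [sqDist, Fintype.sum_prod_type]
  have hinj : Function.Injective
      (fun e : NodePair n × Fin L => ((e.1.1, e.2) : (Fin n × Fin n) × Fin L)) := by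
    rintro ⟨⟨p, hp⟩, l⟩ ⟨⟨p', hp'⟩, l'⟩ h
    simpa using h
  rw [h1]
  refine le_of_eq_of_le (Finset.sum_map Finset.univ ⟨_, hinj⟩
    (fun e : (Fin n × Fin n) × Fin L =>
      ((Lam e.1.1 e.1.2 e.2 : ℝ) - Lam' e.1.1 e.1.2 e.2) ^ 2)).symm ?_
  exact Finset.sum_le_sum_of_subset_of_nonneg (Finset.subset_univ _) fun _ _ _ => sq_nonneg _

/-- The tensors `Lam` and `Lam'` agree wherever `Lam'` is close to zero or to one. -/
def Comparable {n L : ℕ} (Lam Lam' : ProbTensor n L) : Prop :=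
  ∀ i j l, Lam i j l = Lam' i j l ∨ (Lam' i j l : ℝ) ∈ Set.Icc (1 / 4) (3 / 4)

/-- The chi-square affinity is multiplicative over independent edges. The Frobenius norm sees each
edge twice, so it dominates the resulting exponent. -/
lemma sum_sq_obsWeight_div_le {n L : ℕ} {Lam Lam' : ProbTensor n L} (h : Comparable Lam Lam') :
    ∑ a, obsWeight Lam a ^ 2 / obsWeight Lam' a ≤
      Real.exp (6 * sqDist (fun i j l => (Lam i j l : ℝ)) Lam') := by
  have h1 : ∀ a, obsWeight Lam a ^ 2 / obsWeight Lam' a =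
      ∏ e, bernoulliWeight (Lam e.1.1.1 e.1.1.2 e.2) (a e) ^ 2 /
        bernoulliWeight (Lam' e.1.1.1 e.1.1.2 e.2) (a e) := by
    intro a
    simp only [obsWeight, Finset.prod_div_distrib, Finset.prod_pow]
  simp only [h1]
  rw [← Fintype.prod_sum (fun (e : NodePair n × Fin L) x =>
    bernoulliWeight (Lam e.1.1.1 e.1.1.2 e.2) x ^ 2 /
      bernoulliWeight (Lam' e.1.1.1 e.1.1.2 e.2) x)]
  have h2 : ∀ e : NodePair n × Fin L, ∑ x, bernoulliWeight (Lam e.1.1.1 e.1.1.2 e.2) x ^ 2 /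
      bernoulliWeight (Lam' e.1.1.1 e.1.1.2 e.2) x ≤
      Real.exp (6 * ((Lam e.1.1.1 e.1.1.2 e.2 : ℝ) - Lam' e.1.1.1 e.1.1.2 e.2) ^ 2) := fun e =>
    sum_sq_bernoulliWeight_div_le ((h e.1.1.1 e.1.1.2 e.2).imp_left fun h => by rw [h])
  have h3 : ∀ e : NodePair n × Fin L, 0 ≤ ∑ x, bernoulliWeight (Lam e.1.1.1 e.1.1.2 e.2) x ^ 2 /
      bernoulliWeight (Lam' e.1.1.1 e.1.1.2 e.2) x := fun e =>
    Finset.sum_nonneg fun x _ => div_nonneg (sq_nonneg _) (bernoulliWeight_nonneg _ _)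
  refine (Finset.prod_le_prod (fun e _ => h3 e) fun e _ => h2 e).trans ?_
  rw [← Real.exp_sum, ← Finset.mul_sum]
  refine Real.exp_le_exp.2 ?_
  linarith [sum_edges_le_sqDist Lam Lam']

lemma obsWeight_eq_zero {n L : ℕ} {Lam Lam' : ProbTensor n L} (h : Comparable Lam Lam')
    {a : Observation n L} (ha : obsWeight Lam' a = 0) : obsWeight Lam a = 0 := by
  obtain ⟨e, -, he⟩ := Finset.prod_eq_zero_iff.1 ha
  refine Finset.prod_eq_zero (Finset.mem_univ e) ?_
  rcases h e.1.1.1 e.1.1.2 e.2 with h | ⟨h1, h2⟩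
  · rw [h, he]
  · unfold bernoulliWeight at he
    split_ifs at he <;> linarith

lemma sqDist_le {n L : ℕ} (T : Fin n → Fin n → Fin L → ℝ) (Lam Lam' : ProbTensor n L) :
    sqDist (fun i j l => (Lam i j l : ℝ)) Lam' ≤ 2 * sqDist T Lam + 2 * sqDist T Lam' := by
  simp only [sqDist, Finset.mul_sum, ← Finset.sum_add_distrib]
  refine Finset.sum_le_sum fun i _ => Finset.sum_le_sum fun j _ => Finset.sum_le_sum fun l _ => ?_
  nlinarith [sq_nonneg ((T i j l - Lam i j l) + (T i j l - Lam' i j l))]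

/-- The critical case is `N = 2`, where `2 ^ (1 / 100) ≤ 1.015 ≤ 2 * 0.7125²`; beyond it the right
side grows faster. This fixes the exponent `1 / 100`, and with it the factor `600 = 6 * 100` in the
closeness condition below. -/
lemma exp_log_div_le {N : ℕ} (hN : 2 ≤ N) : Real.exp (Real.log N / 100) ≤ 0.7125 ^ 2 * N := by
  have hN' : (2 : ℝ) ≤ N := by exact_mod_cast hN
  have h1 : Real.log N / 100 = Real.log 2 / 100 + Real.log (N / 2) / 100 := by
    rw [Real.log_div (by linarith) (by norm_num)]
    ring
  have h2 : Real.exp (Real.log 2 / 100) ≤ 1.015 := by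
    rw [← Real.le_log_iff_exp_le (by norm_num), div_le_iff₀ (by norm_num), mul_comm,
      ← Real.log_rpow (by norm_num)]
    exact Real.log_le_log (by norm_num) (by norm_num)
  have h3 : Real.exp (Real.log (N / 2) / 100) ≤ N / 2 := by
    have : 0 ≤ Real.log (N / 2) := Real.log_nonneg (by linarith)
    calc Real.exp (Real.log (N / 2) / 100) ≤ Real.exp (Real.log (N / 2)) :=
          Real.exp_le_exp.2 (by linarith)
      _ = N / 2 := Real.exp_log (by linarith)
  rw [h1, Real.exp_add]
  nlinarith [mul_le_mul h2 h3 (Real.exp_pos _).le (by norm_num)]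

/-- The lower bound for the estimation of connection probabilities that results from a product
family of hypotheses. -/
theorem exists_quarter_le_law {A B : Type*} [Fintype A] [Fintype B] [DecidableEq A] [DecidableEq B]
    [Nonempty B] (hA : 2 ≤ Fintype.card A) (a₀ : A) {n L : ℕ} (Lam : (B → A) → ProbTensor n L)
    {r : ℝ} (hr : 0 ≤ r)
    (hsep : ∀ θ θ', r * hammingDist θ θ' ≤ sqDist (fun i j l => (Lam θ i j l : ℝ)) (Lam θ'))
    (hclose : ∀ θ b, 600 * sqDist (fun i j l => (Lam θ i j l : ℝ))
      (Lam (Function.update θ b a₀)) ≤ Real.log (Fintype.card A))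
    (hcomp : ∀ θ b, Comparable (Lam θ) (Lam (Function.update θ b a₀)))
    (est : Observation n L → Fin n → Fin n → Fin L → ℝ) :
    ∃ θ, (1 / 4 : ℝ≥0∞) ≤
      law (Lam θ) {a | r * Fintype.card B / 80 ≤ sqDist (est a) (Lam θ)} := by
  classical
  -- The estimator is decoded to a closest hypothesis.
  have hmin : ∀ a, ∃ θ, ∀ θ', sqDist (est a) (Lam θ) ≤ sqDist (est a) (Lam θ') := fun a =>
    haveI : Nonempty A := ⟨a₀⟩
    Finite.exists_min fun θ => sqDist (est a) (Lam θ)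
  choose d hd using hmin
  obtain ⟨θ, hθ⟩ := exists_quarter_le_sum_hammingDist a₀ (fun θ => obsWeight (Lam θ))
    (fun θ => obsWeight_nonneg _) (fun θ => sum_obsWeight _)
    (fun θ b ω => obsWeight_eq_zero (hcomp θ b))
    (V := Real.exp (Real.log (Fintype.card A) / 100))
    (fun θ b => (sum_sq_obsWeight_div_le (hcomp θ b)).trans
      (Real.exp_le_exp.2 (by linarith [hclose θ b]))) (exp_log_div_le hA) d
  refine ⟨θ, ?_⟩
  rw [law_apply]
  have h14 : (1 / 4 : ℝ≥0∞) = ENNReal.ofReal (1 / 4) := by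
    rw [ENNReal.ofReal_div_of_pos (by norm_num)]
    simp
  rw [h14]
  refine ENNReal.ofReal_le_ofReal (hθ.trans (Finset.sum_le_sum_of_subset_of_nonneg ?_
    fun a _ _ => obsWeight_nonneg _ _))
  intro a ha
  simp only [Finset.mem_filter, Finset.mem_univ, true_and, Set.mem_ofPred_eq] at ha ⊢
  -- Since `Lam (d a)` is closest, the two hypotheses are within `4 * sqDist (est a) (Lam θ)`; this
  -- turns `card B / 20` into `card B / 80`.
  have h1 := hsep (d a) θ
  have h2 := sqDist_le (est a) (Lam (d a)) (Lam θ)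
  have h3 := hd a θ
  nlinarith [mul_le_mul_of_nonneg_left ha hr]

end DSBM

/-! ### Membership in the sparse class -/

namespace DSBM

/-- The unordered pair of two classes. -/
def symPair {m : ℕ} (k k' : Fin m) : ClassPair m := ⟨(min k k', max k k'), min_le_max⟩

lemma symPair_comm {m : ℕ} (k k' : Fin m) : symPair k k' = symPair k' k := by
  simp only [symPair, min_comm, max_comm]

lemma symPair_of_le {m : ℕ} {k k' : Fin m} (h : k ≤ k') : symPair k k' = ⟨(k, k'), h⟩ := by
  simp [symPair, h]

/-- The symmetric connectivity tensor with the given values on unordered pairs. -/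
def symTensor {m L : ℕ} (Q : ClassPair m → Fin L → I) : ProbTensor m L :=
  fun k k' l => Q (symPair k k') l

/-- Because `W = H ⊗ I`, the transform acts on each row of `Q` separately, so sparsity can be
checked row by row. -/
lemma symTensor_mem_sparseTensors {m L s : ℕ} {H : Matrix (Fin L) (Fin L) ℝ}
    {Q : ClassPair m → Fin L → I} (d : Fin L × ClassPair m → ℝ)
    (hQ : ∀ p l, (Q p l : ℝ) = ∑ l', H l' l * d (l', p)) (hd : {x | d x ≠ 0}.ncard ≤ s) :
    symTensor Q ∈ sparseTensors m L s H := by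
  refine ⟨fun k k' l => by simp only [symTensor, symPair_comm], d, ?_, hd⟩
  ext ⟨l, p⟩
  have hp : symPair p.1.1 p.1.2 = p := symPair_of_le p.2
  have h1 : (connMatrix (symTensor Q)).vec (l, p) = Q p l := by
    simp [connMatrix, symTensor, hp]
  rw [h1, hQ]
  simp [transformW, Matrix.mulVec, dotProduct, Fintype.sum_prod_type, Matrix.one_apply]

lemma transpose_mul_self {L : ℕ} {H : Matrix (Fin L) (Fin L) ℝ}
    (hH : H ∈ Matrix.orthogonalGroup (Fin L) ℝ) : Hᵀ * H = 1 :=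
  (Matrix.mem_orthogonalGroup_iff' _ _).1 hH

lemma mul_transpose_self {L : ℕ} {H : Matrix (Fin L) (Fin L) ℝ}
    (hH : H ∈ Matrix.orthogonalGroup (Fin L) ℝ) : H * Hᵀ = 1 :=
  (Matrix.mem_orthogonalGroup_iff _ _).1 hH

lemma TransformCondition.abs_le {L : ℕ} {H : Matrix (Fin L) (Fin L) ℝ}
    (h : TransformCondition H) (i j : Fin L) : |H i j| ≤ 1 / √(L : ℝ) := by
  have h1 := h.1 (Pi.single i 1) (fun l => by
    by_cases hl : l = i
    · subst hl; simp
    · simp [hl]) j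
  have h2 : ∑ l, |(Pi.single i 1 : Fin L → ℝ) l| = 1 := by
    rw [Finset.sum_eq_single i] <;> simp +contextual
  rw [h2] at h1
  simpa using h1

/-- Applying `Hᵀ` to `H 1 = √L e₁` shows that the first row of `H` is constant. A row of `Q` that is
constant in time therefore costs a single coefficient. -/
lemma TransformCondition.zero_apply {L : ℕ} (hL : 0 < L) {H : Matrix (Fin L) (Fin L) ℝ}
    (h : TransformCondition H) (hH : H ∈ Matrix.orthogonalGroup (Fin L) ℝ) (l : Fin L) :
    H ⟨0, hL⟩ l * √(L : ℝ) = 1 := by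
  have h1 : Hᵀ *ᵥ (H *ᵥ (fun _ => (1 : ℝ))) = fun _ => 1 := by
    rw [Matrix.mulVec_mulVec, transpose_mul_self hH, Matrix.one_mulVec]
  rw [h.2] at h1
  have h2 := congrFun h1 l
  simp only [Matrix.mulVec, dotProduct, Matrix.transpose_apply] at h2
  rw [Finset.sum_eq_single ⟨0, hL⟩] at h2
  · simpa using h2
  · intro b _ hb
    have : (b : ℕ) ≠ 0 := fun h => hb (Fin.ext h)
    simp [this]
  · simp

lemma sum_sq_sum_mul {L : ℕ} {H : Matrix (Fin L) (Fin L) ℝ}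
    (hH : H ∈ Matrix.orthogonalGroup (Fin L) ℝ) (v : Fin L → ℝ) :
    ∑ l, (∑ l', H l' l * v l') ^ 2 = ∑ l, v l ^ 2 := by
  have h1 : (Hᵀ *ᵥ v) ⬝ᵥ (Hᵀ *ᵥ v) = v ⬝ᵥ v := by
    rw [Matrix.dotProduct_mulVec, Matrix.vecMul_transpose, Matrix.mulVec_mulVec,
      mul_transpose_self hH, Matrix.one_mulVec]
  simpa [dotProduct, Matrix.mulVec, ← pow_two] using h1

lemma symTensor_const_mem_sparseTensors {m L s : ℕ} (hL : 0 < L) {H : Matrix (Fin L) (Fin L) ℝ}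
    (hH : H ∈ Matrix.orthogonalGroup (Fin L) ℝ) (h : TransformCondition H)
    (q : ClassPair m → I) (P : Finset (ClassPair m)) (hP : P.card ≤ s) (hq : ∀ p ∉ P, q p = 0) :
    symTensor (fun p (_ : Fin L) => q p) ∈ sparseTensors m L s H := by
  refine symTensor_mem_sparseTensors
    (fun x => if x.1 = ⟨0, hL⟩ then √(L : ℝ) * q x.2 else 0) (fun p l => ?_) ?_
  · simp only [mul_ite, mul_zero, Finset.sum_ite_eq', Finset.mem_univ, if_true]
    rw [← mul_assoc, h.zero_apply hL hH, one_mul]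
  · refine le_trans ?_ hP
    rw [← Set.ncard_coe_finset]
    refine le_trans (Set.ncard_le_ncard (t := (fun p => ((⟨0, hL⟩, p) : Fin L × ClassPair m)) ''
      (P : Set (ClassPair m))) ?_ (Set.toFinite _)) (Set.ncard_image_le (Set.toFinite _))
    rintro ⟨l, p⟩ hx
    by_cases hl : l = ⟨0, hL⟩
    · refine ⟨p, ?_, by simp [hl]⟩
      by_contra hp
      exact hx (by simp [hq p hp])
    · exact absurd (by simp [hl]) hx

lemma symTensor_mem_sparseTensors_of_support {m L s : ℕ} {H : Matrix (Fin L) (Fin L) ℝ}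
    (hH : H ∈ Matrix.orthogonalGroup (Fin L) ℝ)
    (Q : ClassPair m → Fin L → I) (P : Finset (ClassPair m)) (hP : L * P.card ≤ s)
    (hQ : ∀ p ∉ P, ∀ l, Q p l = 0) : symTensor Q ∈ sparseTensors m L s H := by
  refine symTensor_mem_sparseTensors (fun x => (H *ᵥ (fun l => (Q x.2 l : ℝ))) x.1)
    (fun p l => ?_) ?_
  · have h1 : Hᵀ *ᵥ (H *ᵥ (fun l => (Q p l : ℝ))) = fun l => (Q p l : ℝ) := by
      rw [Matrix.mulVec_mulVec, transpose_mul_self hH, Matrix.one_mulVec]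
    exact (congrFun h1 l).symm
  · refine le_trans ?_ hP
    have h2 := Set.ncard_coe_finset ((Finset.univ : Finset (Fin L)) ×ˢ P)
    rw [Finset.card_product, Finset.card_univ, Fintype.card_fin] at h2
    rw [← h2]
    refine Set.ncard_le_ncard ?_ (Set.toFinite _)
    rintro ⟨l, p⟩ hx
    by_contra hp
    have hp' : p ∉ P := by simpa using hp
    exact hx (by simp [Matrix.mulVec, dotProduct, hQ p hp'])

end DSBM

/-! ### Clustering hypotheses built on a connectivity pattern -/

namespace DSBM

/-- A connectivity pattern that makes clusterings hard to estimate. Nodes `j ≥ n / 2` have the fixed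
classes `col j`, the other nodes have one of the classes `row k`. Connections are possible between
the pairs of classes in `supp`, and have an increased probability for the pairs in `high`. Different
rows are distinguished by a positive proportion of the nodes with fixed class. -/
structure Pattern (m n K : ℕ) where
  row : Fin (K + 1) → Fin m
  col : Fin n → Fin m
  supp : ClassPair m → Bool
  high : ClassPair m → Bool
  rowSupp : Bool
  supp_row : ∀ k k', supp (symPair (row k) (row k')) = rowSupp
  supp_col : ∀ k j, supp (symPair (row k) (col j)) = true
  sep : ∀ k k', k ≠ k' → n ≤ 8 * (Finset.univ.filter fun j : Fin n => n / 2 ≤ (j : ℕ) ∧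
    high (symPair (row k) (col j)) ≠ high (symPair (row k') (col j))).card

namespace Pattern

variable {m n K : ℕ} (P : Pattern m n K)

lemma row_injective (hn : 0 < n) : Function.Injective P.row := by
  intro k k' h
  by_contra hne
  have := P.sep k k' hne
  simp only [h, ne_eq, not_true_eq_false, and_false, Finset.filter_false, Finset.card_empty] at this
  omega

lemma card_le (P' : Pattern m n K) (hn : 0 < n) : K + 1 ≤ m := by
  simpa using Fintype.card_le_of_injective _ (P'.row_injective hn)

/-- The connection probabilities of a pattern. -/
noncomputable def prob (ε : Set.Icc (0 : ℝ) (1 / 4)) (p : ClassPair m) : I :=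
  ⟨if P.supp p then 1 / 2 + (if P.high p then (ε : ℝ) else 0) else 0, by
    have := ε.2.1
    have := ε.2.2
    split_ifs <;> constructor <;> linarith⟩

lemma prob_mem (ε : Set.Icc (0 : ℝ) (1 / 4)) {p : ClassPair m} (hp : P.supp p = true) :
    (P.prob ε p : ℝ) ∈ Set.Icc (1 / 4) (3 / 4) := by
  have := ε.2.1
  have := ε.2.2
  simp only [prob, hp, if_true]
  split_ifs <;> constructor <;> linarith

lemma prob_of_supp_eq_false (ε : Set.Icc (0 : ℝ) (1 / 4)) {p : ClassPair m}
    (hp : P.supp p = false) : P.prob ε p = 0 := by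
  ext
  simp [prob, hp]

lemma sq_prob_sub_le (ε : Set.Icc (0 : ℝ) (1 / 4)) {p p' : ClassPair m} (h : P.supp p = P.supp p') :
    ((P.prob ε p : ℝ) - P.prob ε p') ^ 2 ≤ (ε : ℝ) ^ 2 := by
  simp only [prob, h]
  split_ifs <;> nlinarith [sq_nonneg (ε : ℝ)]

lemma sq_prob_sub_eq (ε : Set.Icc (0 : ℝ) (1 / 4)) {p p' : ClassPair m} (hp : P.supp p = true)
    (hp' : P.supp p' = true) (h : P.high p ≠ P.high p') :
    ((P.prob ε p : ℝ) - P.prob ε p') ^ 2 = (ε : ℝ) ^ 2 := by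
  simp only [prob, hp, hp', if_true]
  cases h1 : P.high p <;> cases h2 : P.high p' <;> simp_all

variable {L : ℕ}

/-- The clusterings in which the nodes `i < n / 2` have the classes given by row numbers. -/
def assign (w : Fin L × Fin (n / 2) → Fin (K + 1)) : Fin L → Fin n → Fin m := fun l i =>
  if h : (i : ℕ) < n / 2 then P.row (w (l, ⟨i, h⟩)) else P.col i

/-- Changing row numbers never moves a node pair into or out of the support. This is what makes all
tensors of one pattern comparable, although some entries vanish. -/
lemma supp_assign (w w' : Fin L × Fin (n / 2) → Fin (K + 1)) (l : Fin L) (i j : Fin n) :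
    P.supp (symPair (P.assign w l i) (P.assign w l j)) =
      P.supp (symPair (P.assign w' l i) (P.assign w' l j)) := by
  unfold assign
  split_ifs
  · rw [P.supp_row, P.supp_row]
  · rw [P.supp_col, P.supp_col]
  · rw [symPair_comm, P.supp_col, symPair_comm, P.supp_col]
  · rfl

/-- The tensor of connection probabilities for a pattern and row numbers. -/
noncomputable def tensor (ε : Set.Icc (0 : ℝ) (1 / 4)) (w : Fin L × Fin (n / 2) → Fin (K + 1)) :
    ProbTensor n L :=
  connProb (symTensor fun p _ => P.prob ε p) (P.assign w)

lemma tensor_of_ne (ε : Set.Icc (0 : ℝ) (1 / 4)) (w : Fin L × Fin (n / 2) → Fin (K + 1))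
    {i j : Fin n} (h : i ≠ j) (l : Fin L) :
    P.tensor ε w i j l = P.prob ε (symPair (P.assign w l i) (P.assign w l j)) := by
  simp [tensor, connProb, symTensor, h]

lemma tensor_self (ε : Set.Icc (0 : ℝ) (1 / 4)) (w : Fin L × Fin (n / 2) → Fin (K + 1))
    (i : Fin n) (l : Fin L) : P.tensor ε w i i l = 0 := by
  simp [tensor, connProb]

lemma comparable_tensor (ε : Set.Icc (0 : ℝ) (1 / 4))
    (w w' : Fin L × Fin (n / 2) → Fin (K + 1)) :
    Comparable (P.tensor ε w) (P.tensor ε w') := by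
  intro i j l
  by_cases h : i = j
  · subst h
    left
    rw [tensor_self, tensor_self]
  rw [P.tensor_of_ne ε w h, P.tensor_of_ne ε w' h]
  cases h1 : P.supp (symPair (P.assign w' l i) (P.assign w' l j))
  · left
    rw [P.prob_of_supp_eq_false ε h1,
      P.prob_of_supp_eq_false ε ((P.supp_assign w w' l i j).trans h1)]
  · exact Or.inr (P.prob_mem ε h1)

lemma sum_sq_tensor_ge (ε : Set.Icc (0 : ℝ) (1 / 4)) (w w' : Fin L × Fin (n / 2) → Fin (K + 1))
    (l : Fin L) (i : Fin (n / 2)) (h : w (l, i) ≠ w' (l, i)) :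
    n / 8 * (ε : ℝ) ^ 2 ≤ ∑ j, ((P.tensor ε w (i.castLE (Nat.div_le_self n 2)) j l : ℝ) -
      P.tensor ε w' (i.castLE (Nat.div_le_self n 2)) j l) ^ 2 := by
  set i' := i.castLE (Nat.div_le_self n 2) with hi'
  set S := Finset.univ.filter fun j : Fin n => n / 2 ≤ (j : ℕ) ∧
    P.high (symPair (P.row (w (l, i))) (P.col j)) ≠ P.high (symPair (P.row (w' (l, i))) (P.col j))
    with hS
  have h1 : (n : ℝ) ≤ 8 * S.card := by exact_mod_cast P.sep _ _ h
  have h2 : ∀ j ∈ S, ((P.tensor ε w i' j l : ℝ) - P.tensor ε w' i' j l) ^ 2 = (ε : ℝ) ^ 2 := by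
    intro j hj
    simp only [hS, Finset.mem_filter, Finset.mem_univ, true_and] at hj
    have hlt : (i' : ℕ) < n / 2 := i.2
    have hne : i' ≠ j := fun h => by rw [h] at hlt; omega
    have hj' : ¬ (j : ℕ) < n / 2 := by omega
    have ha : ∀ v : Fin L × Fin (n / 2) → Fin (K + 1), P.assign v l i' = P.row (v (l, i)) := by
      intro v
      simp only [assign, hlt, dif_pos]
      rfl
    have hb : ∀ v : Fin L × Fin (n / 2) → Fin (K + 1), P.assign v l j = P.col j := by
      intro v
      simp only [assign, hj', dif_neg, not_false_iff]
    rw [P.tensor_of_ne ε w hne, P.tensor_of_ne ε w' hne, ha, ha, hb, hb]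
    exact P.sq_prob_sub_eq ε (P.supp_col _ _) (P.supp_col _ _) hj.2
  calc n / 8 * (ε : ℝ) ^ 2 ≤ S.card * (ε : ℝ) ^ 2 := by nlinarith [sq_nonneg (ε : ℝ)]
    _ = ∑ j ∈ S, ((P.tensor ε w i' j l : ℝ) - P.tensor ε w' i' j l) ^ 2 := by
        rw [Finset.sum_congr rfl h2, Finset.sum_const, nsmul_eq_mul]
    _ ≤ _ := Finset.sum_le_sum_of_subset_of_nonneg (Finset.subset_univ _) fun _ _ _ => sq_nonneg _

/-- Only pairs of a free node with a fixed node are counted. For them the differences at distinct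
free nodes do not interfere, and each wrong row number contributes at least `n / 8` entries of size
`ε²`. -/
lemma le_sqDist_tensor (ε : Set.Icc (0 : ℝ) (1 / 4))
    (w w' : Fin L × Fin (n / 2) → Fin (K + 1)) :
    n / 8 * (ε : ℝ) ^ 2 * hammingDist w w' ≤
      sqDist (fun i j l => (P.tensor ε w i j l : ℝ)) (P.tensor ε w') := by
  have h1 : sqDist (fun i j l => (P.tensor ε w i j l : ℝ)) (P.tensor ε w') =
      ∑ l, ∑ i, ∑ j, ((P.tensor ε w i j l : ℝ) - P.tensor ε w' i j l) ^ 2 := by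
    rw [sqDist, Finset.sum_comm]
    simp_rw [Finset.sum_comm (γ := Fin L)]
    rw [Finset.sum_comm]
  have h2 : (hammingDist w w' : ℝ) =
      ∑ l, ∑ i, if w (l, i) ≠ w' (l, i) then (1 : ℝ) else 0 := by
    rw [hammingDist, Finset.card_filter, Nat.cast_sum, Fintype.sum_prod_type]
    simp
  rw [h1, h2, Finset.mul_sum]
  refine Finset.sum_le_sum fun l _ => ?_
  rw [Finset.mul_sum]
  have h3 : ∑ i : Fin (n / 2), ∑ j,
      ((P.tensor ε w (i.castLE (Nat.div_le_self n 2)) j l : ℝ) -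
        P.tensor ε w' (i.castLE (Nat.div_le_self n 2)) j l) ^ 2 ≤
      ∑ i, ∑ j, ((P.tensor ε w i j l : ℝ) - P.tensor ε w' i j l) ^ 2 := by
    refine le_of_eq_of_le (Finset.sum_map Finset.univ (Fin.castLEEmb (Nat.div_le_self n 2))
      (fun i => ∑ j, ((P.tensor ε w i j l : ℝ) - P.tensor ε w' i j l) ^ 2)).symm ?_
    exact Finset.sum_le_sum_of_subset_of_nonneg (Finset.subset_univ _)
      fun _ _ _ => Finset.sum_nonneg fun _ _ => sq_nonneg _
  refine (Finset.sum_le_sum fun i _ => ?_).trans h3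
  split_ifs with h
  · rw [mul_one]
    exact P.sum_sq_tensor_ge ε w w' l i h
  · rw [mul_zero]
    exact Finset.sum_nonneg fun _ _ => sq_nonneg _

lemma sqDist_tensor_le (ε : Set.Icc (0 : ℝ) (1 / 4))
    (w w' : Fin L × Fin (n / 2) → Fin (K + 1)) :
    sqDist (fun i j l => (P.tensor ε w i j l : ℝ)) (P.tensor ε w') ≤
      2 * n * (ε : ℝ) ^ 2 * hammingDist w w' := by
  -- Indicator that a node has changed its row number; an entry can differ only if one of its two
  -- nodes has changed.
  let g : Fin L → Fin n → ℝ := fun l i =>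
    if h : (i : ℕ) < n / 2 then (if w (l, ⟨i, h⟩) ≠ w' (l, ⟨i, h⟩) then 1 else 0) else 0
  have hg : ∀ l i, 0 ≤ g l i := fun l i => by
    simp only [g]
    split_ifs <;> norm_num
  have hg1 : ∀ l i, P.assign w l i ≠ P.assign w' l i → g l i = 1 := by
    intro l i h
    by_cases hi : (i : ℕ) < n / 2
    · simp only [assign, hi, dif_pos] at h
      have : w (l, ⟨i, hi⟩) ≠ w' (l, ⟨i, hi⟩) := fun h' => h (by rw [h'])
      simp [g, hi, this]
    · simp [assign, hi] at h
  have hsum : ∑ l, ∑ i, g l i = hammingDist w w' := by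
    rw [hammingDist, Finset.card_filter, Nat.cast_sum, Fintype.sum_prod_type]
    refine Finset.sum_congr rfl fun l _ => (Finset.sum_of_injOn (Fin.castLE (Nat.div_le_self n 2))
      (Fin.castLE_injective _).injOn (fun _ _ => Finset.mem_coe.2 (Finset.mem_univ _)) ?_ ?_).symm
    · intro i _ hi
      have : ¬ (i : ℕ) < n / 2 := fun h => hi ⟨⟨i, h⟩, by simp, rfl⟩
      simp [g, this]
    · intro i _
      simp [g]
  have hpt : ∀ i j l, ((P.tensor ε w i j l : ℝ) - P.tensor ε w' i j l) ^ 2 ≤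
      (ε : ℝ) ^ 2 * g l i + (ε : ℝ) ^ 2 * g l j := by
    intro i j l
    have h0 : 0 ≤ (ε : ℝ) ^ 2 * g l i := mul_nonneg (sq_nonneg _) (hg _ _)
    have h0' : 0 ≤ (ε : ℝ) ^ 2 * g l j := mul_nonneg (sq_nonneg _) (hg _ _)
    by_cases h : i = j
    · subst h
      rw [tensor_self, tensor_self, sub_self]
      simpa using h0
    rw [P.tensor_of_ne ε w h, P.tensor_of_ne ε w' h]
    have h1 := P.sq_prob_sub_le ε (P.supp_assign w w' l i j)
    by_cases hi : P.assign w l i = P.assign w' l i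
    · by_cases hj : P.assign w l j = P.assign w' l j
      · rw [hi, hj, sub_self]
        linarith
      · rw [hg1 l j hj] at *
        linarith
    · rw [hg1 l i hi] at *
      linarith
  calc sqDist (fun i j l => (P.tensor ε w i j l : ℝ)) (P.tensor ε w')
      ≤ ∑ i, ∑ j, ∑ l, ((ε : ℝ) ^ 2 * g l i + (ε : ℝ) ^ 2 * g l j) :=
        Finset.sum_le_sum fun i _ => Finset.sum_le_sum fun j _ => Finset.sum_le_sum fun l _ =>
          hpt i j l
    _ = 2 * n * (ε : ℝ) ^ 2 * ∑ l, ∑ i, g l i := by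
        rw [Finset.sum_comm (s := Finset.univ (α := Fin L))]
        simp only [Finset.sum_add_distrib, ← Finset.mul_sum, Finset.sum_const, Finset.card_univ,
          Fintype.card_fin, nsmul_eq_mul]
        ring
    _ = _ := by rw [hsum]

theorem exists_quarter_le_law {s n₀ : ℕ} (hn : 0 < n) (hL : 0 < L)
    {H : Matrix (Fin L) (Fin L) ℝ} (hH : H ∈ Matrix.orthogonalGroup (Fin L) ℝ)
    (hT : TransformCondition H)
    (hs : (Finset.univ.filter fun p => P.supp p = true).card ≤ s)
    {A B : Type*} [Fintype A] [Fintype B] [DecidableEq A] [DecidableEq B]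
    [Nonempty B] (hA : 2 ≤ Fintype.card A) (a₀ : A)
    (w : (B → A) → Fin L × Fin (n / 2) → Fin (K + 1)) {c : ℕ} (hc : 0 < c)
    (hlow : ∀ θ θ', c * hammingDist θ θ' ≤ hammingDist (w θ) (w θ'))
    (hup : ∀ θ b, hammingDist (w θ) (w (Function.update θ b a₀)) ≤ c)
    (hz : ∀ θ, P.assign (w θ) ∈ clusterings m n n₀ L)
    (hlog : Real.log (Fintype.card A) ≤ 75 * (c * n))
    (est : Observation n L → Fin n → Fin n → Fin L → ℝ) :
    ∃ G ∈ sparseTensors m L s H, ∃ z ∈ clusterings m n n₀ L, (1 / 4 : ℝ≥0∞) ≤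
      law (connProb G z) {a | Real.log (Fintype.card A) * Fintype.card B / 768000 ≤
        sqDist (est a) (connProb G z)} := by
  have hcn : (0 : ℝ) < c * n := by positivity
  have hlog0 : 0 ≤ Real.log (Fintype.card A) := Real.log_natCast_nonneg _
  -- The largest `ε²` compatible with the closeness condition, since `600 * 2 = 1200`. Then `r = log
  -- (card A) / 9600`, and `9600 * 80 = 768000`.
  set x := Real.log (Fintype.card A) / (1200 * (c * n)) with hx
  have hx0 : 0 ≤ x := by positivity
  have hx1 : x ≤ (1 / 4) ^ 2 := by
    rw [hx, div_le_iff₀ (by positivity)]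
    linarith
  let ε : Set.Icc (0 : ℝ) (1 / 4) := ⟨√x, Real.sqrt_nonneg _, Real.sqrt_le_iff.2 ⟨by norm_num, hx1⟩⟩
  have hε : (ε : ℝ) ^ 2 = x := Real.sq_sqrt hx0
  have hxc : 1200 * (c * n * x) = Real.log (Fintype.card A) := by
    rw [hx]
    field_simp
  obtain ⟨θ, hθ⟩ := DSBM.exists_quarter_le_law hA a₀ (fun θ => P.tensor ε (w θ))
    (r := n / 8 * x * c) (by positivity) (fun θ θ' => by
      refine le_trans ?_ (P.le_sqDist_tensor ε (w θ) (w θ'))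
      rw [hε, mul_assoc]
      refine mul_le_mul_of_nonneg_left ?_ (by positivity)
      exact_mod_cast hlow θ θ') (fun θ b => by
      have h1 := P.sqDist_tensor_le ε (w θ) (w (Function.update θ b a₀))
      have h2 : (hammingDist (w θ) (w (Function.update θ b a₀)) : ℝ) ≤ c := by
        exact_mod_cast hup θ b
      rw [hε] at h1
      have h3 := mul_le_mul_of_nonneg_left h2 (by positivity : 0 ≤ 2 * n * x)
      linarith) (fun θ b => P.comparable_tensor ε _ _) est
  refine ⟨_, symTensor_const_mem_sparseTensors hL hH hT (P.prob ε) _ hs (fun p hp => ?_),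
    _, hz θ, le_of_le_of_eq hθ ?_⟩
  · refine P.prob_of_supp_eq_false ε ?_
    simpa using hp
  · have : n / 8 * x * c * Fintype.card B / 80 =
        Real.log (Fintype.card A) * Fintype.card B / 768000 := by
      rw [← hxc]
      ring
    simp only [this]
    rfl

end Pattern

end DSBM

/-! ### Existence of patterns of a given sparsity -/

namespace DSBM

/-- The rows of a Sylvester–Hadamard matrix: any two of them differ in half of the columns. -/
lemma exists_code {N t : ℕ} (hN : N = 2 ^ t) : ∃ c : Fin N → Fin N → Bool, ∀ k k', k ≠ k' →
    2 * (Finset.univ.filter fun x => c k x ≠ c k' x).card = N := by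
  have e : Fin N ≃ (Fin t → ZMod 2) := Fintype.equivOfCardEq (by simp [hN, ZMod.card])
  refine ⟨fun k x => decide (e k ⬝ᵥ e x = 0), fun k k' hk => ?_⟩
  have hz : ∀ a b : ZMod 2, (decide (a = 0) ≠ decide (b = 0)) ↔ a - b ≠ 0 := by decide
  have hz' : ∀ a : ZMod 2, a ≠ 0 ↔ a + 1 = 0 := by decide
  have hz'' : ∀ a : ZMod 2, a ≠ 0 → a = 1 := by decide
  have hne : e k - e k' ≠ 0 := sub_ne_zero.2 fun h => hk (e.injective h)
  obtain ⟨i, hi⟩ := Function.ne_iff.1 hne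
  have hi1 : (e k - e k') i = 1 := hz'' _ hi
  have h1 : (Finset.univ.filter fun x => decide (e k ⬝ᵥ e x = 0) ≠ decide (e k' ⬝ᵥ e x = 0)).card =
      (Finset.univ.filter fun v => (e k - e k') ⬝ᵥ v ≠ 0).card := by
    refine Finset.card_equiv e fun x => ?_
    simp only [Finset.mem_filter, Finset.mem_univ, true_and, hz, sub_dotProduct]
  -- Adding the `i`-th unit vector flips the value of a functional whose `i`-th coordinate is `1`,
  -- so zeros and nonzeros are equinumerous.
  have h2 : (Finset.univ.filter fun v => (e k - e k') ⬝ᵥ v ≠ 0).card =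
      (Finset.univ.filter fun v => ¬ (e k - e k') ⬝ᵥ v ≠ 0).card := by
    refine Finset.card_equiv (Equiv.addRight (Pi.single i 1)) fun v => ?_
    simp only [Finset.mem_filter, Finset.mem_univ, true_and, Equiv.coe_addRight, dotProduct_add,
      dotProduct_single, hi1, mul_one, not_not]
    exact hz' _
  have h3 := Finset.card_filter_add_card_filter_not (s := (Finset.univ : Finset (Fin t → ZMod 2)))
    (fun v => (e k - e k') ⬝ᵥ v ≠ 0)
  rw [h1, two_mul]
  rw [← h2] at h3
  rw [h3]
  simp [hN, ZMod.card]

lemma card_mul_le_card_filter_mod {N : ℕ} (hN : 0 < N) (D : Finset (Fin N)) {u h n : ℕ}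
    (hn : u + N * h ≤ n) : D.card * h ≤ (Finset.univ.filter fun j : Fin n => u ≤ (j : ℕ) ∧
      (⟨((j : ℕ) - u) % N, Nat.mod_lt _ hN⟩ : Fin N) ∈ D).card := by
  have h1 : D.card * h = (D ×ˢ (Finset.univ : Finset (Fin h))).card := by simp
  have hlt : ∀ (x : Fin N) (y : Fin h), u + (N * y + x) < n := by
    intro x y
    have : N * ((y : ℕ) + 1) ≤ N * h := Nat.mul_le_mul_left _ y.2
    have := x.2
    rw [Nat.mul_add] at *
    omega
  rw [h1]
  refine Finset.card_le_card_of_injOn (fun p => ⟨u + (N * p.2 + p.1), hlt p.1 p.2⟩) ?_ ?_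
  · rintro ⟨x, y⟩ hp
    have hx : x ∈ D := by simpa using hp
    have : ((u + (N * y + x) - u) % N : ℕ) = x := by
      rw [Nat.add_sub_cancel_left, Nat.mul_add_mod, Nat.mod_eq_of_lt x.2]
    simp only [Finset.coe_filter, Finset.mem_univ, true_and, Set.mem_ofPred_eq, this]
    exact ⟨Nat.le_add_right _ _, hx⟩
  · rintro ⟨x, y⟩ - ⟨x', y'⟩ - h
    have h2 : N * (y : ℕ) + x = N * y' + x' := by simpa using h
    have h3 : (x : ℕ) = x' := by
      have := congrArg (· % N) h2
      simpa [Nat.mul_add_mod, Nat.mod_eq_of_lt x.2, Nat.mod_eq_of_lt x'.2] using this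
    have h4 : (y : ℕ) = y' := by
      rw [h3] at h2
      exact Nat.eq_of_mul_eq_mul_left hN (by omega)
    exact Prod.ext (Fin.ext h3) (Fin.ext h4)

namespace Pattern

/-- Classes `0, …, K` serve as rows and the next `K + 1` classes as columns, joined by a Hadamard
code. The support is the rectangle of row-column pairs, of size `(K + 1)²`, and the fixed nodes run
cyclically through the columns. -/
lemma exists_of_pow {m n s K t : ℕ} (hK : K + 1 = 2 ^ t) (hm : 2 * (K + 1) ≤ m)
    (hs : (K + 1) ^ 2 ≤ s) (hn : 2 * m ≤ n) :
    ∃ P : Pattern m n K, (Finset.univ.filter fun p => P.supp p = true).card ≤ s := by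
  obtain ⟨c, hc⟩ := exists_code hK
  have hmod : ∀ x, x % (K + 1) < K + 1 := fun x => Nat.mod_lt _ K.succ_pos
  let row : Fin (K + 1) → Fin m := fun k => ⟨k, by omega⟩
  let col : Fin n → Fin m := fun j => ⟨K + 1 + ((j : ℕ) - n / 2) % (K + 1), by
    have := hmod ((j : ℕ) - n / 2)
    omega⟩
  have hrc : ∀ k j, symPair (row k) (col j) = ⟨(row k, col j), by
      have := k.2
      simp only [row, col, Fin.mk_le_mk]
      omega⟩ := fun k j => symPair_of_le _
  let high : ClassPair m → Bool := fun p =>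
    if h : (p.1.1 : ℕ) < K + 1 then c ⟨p.1.1, h⟩ ⟨(p.1.2 : ℕ) % (K + 1), hmod _⟩ else false
  have hhigh : ∀ k j, high (symPair (row k) (col j)) =
      c k ⟨((j : ℕ) - n / 2) % (K + 1), hmod _⟩ := by
    intro k j
    rw [hrc]
    have := Nat.le_of_lt_succ k.2
    simp [high, row, col, this]
  refine ⟨⟨row, col, fun p => decide ((p.1.1 : ℕ) < K + 1 ∧ K + 1 ≤ (p.1.2 : ℕ) ∧
    (p.1.2 : ℕ) < 2 * (K + 1)), high, false, ?_, ?_, ?_⟩, ?_⟩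
  · intro k k'
    have := k.2
    have := k'.2
    refine decide_eq_false ?_
    simp only [symPair, row]
    rintro ⟨-, h, -⟩
    rcases le_total k k' with hk | hk
    · rw [max_eq_right (by exact hk)] at h
      simp at h
      omega
    · rw [max_eq_left (by exact hk)] at h
      simp at h
      omega
  · intro k j
    have := hmod ((j : ℕ) - n / 2)
    rw [hrc]
    simp only [row, col, decide_eq_true_eq]
    have := k.2
    omega
  · intro k k' hk
    have h1 := card_mul_le_card_filter_mod K.succ_pos (Finset.univ.filter fun x => c k x ≠ c k' x)
      (u := n / 2) (h := (n - n / 2) / (K + 1)) (n := n) (by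
        have := Nat.mul_div_le (n - n / 2) (K + 1)
        have : n / 2 ≤ n := Nat.div_le_self _ _
        simp only [Nat.succ_eq_add_one]
        omega)
    have h2 := hc k k' hk
    simp only [hhigh]
    simp only [Finset.mem_filter, Finset.mem_univ, true_and] at h1
    -- An incomplete last cycle loses fewer than `K + 1 ≤ n / 4` of the at least `n / 2` fixed
    -- nodes. Half of the rest separates two rows, which accounts for the `8` in `sep`.
    have h3 := Nat.lt_mul_div_succ (n - n / 2) K.succ_pos
    refine le_trans ?_ (Nat.mul_le_mul_left 8 h1)
    rw [Nat.mul_add] at h3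
    have h4 : 8 * ((Finset.univ.filter fun x => c k x ≠ c k' x).card *
        ((n - n / 2) / (K + 1))) = 4 * ((K + 1) * ((n - n / 2) / (K + 1))) := by
      have : ∀ a b d : ℕ, 2 * a = b → 8 * (a * d) = 4 * (b * d) := by
        rintro a b d rfl
        ring
      exact this _ _ _ h2
    rw [h4]
    simp only [Nat.succ_eq_add_one] at h3
    omega
  · refine le_trans ?_ hs
    have h1 : (K + 1) ^ 2 = (Finset.univ : Finset (Fin (K + 1) × Fin (K + 1))).card := by
      simp [pow_two]
    rw [h1]
    refine Finset.card_le_card_of_injOn (fun p => (⟨(p.1.1 : ℕ) % (K + 1), hmod _⟩,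
      ⟨(p.1.2 : ℕ) % (K + 1), hmod _⟩)) (fun _ _ => Finset.mem_coe.2 (Finset.mem_univ _)) ?_
    intro p hp p' hp' h
    simp only [Finset.coe_filter, Finset.mem_univ, true_and, decide_eq_true_eq,
      Set.mem_ofPred_eq] at hp hp'
    simp only [Prod.mk.injEq, Fin.mk.injEq] at h
    rw [Nat.mod_eq_of_lt hp.1, Nat.mod_eq_of_lt hp'.1, Nat.mod_eq_sub_mod hp.2.1,
      Nat.mod_eq_sub_mod hp'.2.1, Nat.mod_eq_of_lt (by omega), Nat.mod_eq_of_lt (by omega)] at h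
    exact Subtype.ext (Prod.ext (Fin.ext h.1) (Fin.ext (by omega)))

lemma le_card_filter_half (n : ℕ) :
    n ≤ 8 * (Finset.univ.filter fun j : Fin n => n / 2 ≤ (j : ℕ)).card := by
  have h1 := card_mul_le_card_filter_mod one_pos Finset.univ (u := n / 2) (h := n - n / 2) (n := n)
    (by omega)
  have h2 : (Finset.univ.filter fun j : Fin n => n / 2 ≤ (j : ℕ) ∧
      (⟨((j : ℕ) - n / 2) % 1, Nat.mod_lt _ one_pos⟩ : Fin 1) ∈ Finset.univ) =
      Finset.univ.filter fun j : Fin n => n / 2 ≤ (j : ℕ) :=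
    Finset.filter_congr fun _ _ => and_iff_left (Finset.mem_univ _)
  rw [h2] at h1
  simp only [Finset.card_univ, Fintype.card_fin, one_mul] at h1
  omega

/-- Two row classes and one further column class need only two supported pairs. -/
lemma exists_of_three_le {m n s : ℕ} (hm : 3 ≤ m) (hs : 2 ≤ s) :
    ∃ P : Pattern m n 1, (Finset.univ.filter fun p => P.supp p = true).card ≤ s := by
  let row : Fin 2 → Fin m := fun k => ⟨k, by omega⟩
  let c : Fin m := ⟨2, by omega⟩
  have hrc : ∀ k, symPair (row k) c = ⟨(row k, c), by
      simp only [row, c, Fin.mk_le_mk]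
      omega⟩ := fun k => symPair_of_le _
  refine ⟨⟨row, fun _ => c, fun p => decide ((p.1.1 : ℕ) < 2 ∧ p.1.2 = c),
    fun p => decide ((p.1.1 : ℕ) = 0), false, ?_, ?_, ?_⟩, ?_⟩
  · intro k k'
    have := k.2
    have := k'.2
    refine decide_eq_false ?_
    simp only [symPair, row, c, Fin.ext_iff]
    rintro ⟨-, h⟩
    rcases le_total k k' with hk | hk
    · rw [max_eq_right (by exact hk)] at h
      simp at h
      omega
    · rw [max_eq_left (by exact hk)] at h
      simp at h
      omega
  · intro k _
    rw [hrc]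
    simp [row]
    omega
  · intro k k' hk
    have h1 : decide ((row k : ℕ) = 0) ≠ decide ((row k' : ℕ) = 0) := by
      have : ∀ k k' : Fin 2, k ≠ k' → decide ((k : ℕ) = 0) ≠ decide ((k' : ℕ) = 0) := by decide
      exact this k k' hk
    simpa only [hrc, h1, ne_eq, not_false_iff, and_true] using le_card_filter_half n
  · refine le_trans ?_ hs
    have h1 : 2 = (Finset.univ : Finset (Fin 2)).card := by simp
    conv_rhs => rw [h1]
    refine Finset.card_le_card_of_injOn (fun p => ⟨(p.1.1 : ℕ) % 2, Nat.mod_lt _ two_pos⟩)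
      (fun _ _ => Finset.mem_coe.2 (Finset.mem_univ _)) ?_
    intro p hp p' hp' h
    simp only [Finset.coe_filter, Finset.mem_univ, true_and, decide_eq_true_eq,
      Set.mem_ofPred_eq] at hp hp'
    simp only [Fin.mk.injEq] at h
    exact Subtype.ext (Prod.ext (Fin.ext (by omega)) (hp.2.trans hp'.2.symm))

/-- With two classes none is left to be a separate column class: class `0` plays both parts, and all
three pairs are supported. This is why `m = s = 2` is excluded. -/
lemma exists_of_two {n s : ℕ} (hs : 3 ≤ s) :
    ∃ P : Pattern 2 n 1, (Finset.univ.filter fun p => P.supp p = true).card ≤ s := by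
  refine ⟨⟨id, fun _ => 0, fun _ => true, fun p => decide (p.1.2 = 0), true, fun _ _ => rfl,
    fun _ _ => rfl, ?_⟩, ?_⟩
  · intro k k' hk
    have h1 : decide ((symPair k 0).1.2 = 0) ≠ decide ((symPair k' 0).1.2 = 0) := by
      revert k k'
      decide
    simpa only [id, h1, ne_eq, not_false_iff, and_true] using le_card_filter_half n
  · refine le_trans ?_ hs
    simp only [Finset.filter_true]
    decide

theorem exists_of_sparsity {γ : ℝ} (hγ : 0 < γ) (hγ1 : γ ≤ 1 / 2) {m n s : ℕ} (hm : 2 ≤ m)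
    (hs : 2 ≤ s) (hms : ¬ (m = 2 ∧ s = 2)) (hγs : γ * (m : ℝ) ^ 2 ≤ s) (hn : 2 * m ≤ n) :
    ∃ K : ℕ, 1 ≤ K ∧ γ * m ≤ 2 * (K + 1) ∧ ∃ P : Pattern m n K,
      (Finset.univ.filter fun p => P.supp p = true).card ≤ s := by
  have hm0 : (2 : ℝ) ≤ m := by exact_mod_cast hm
  have hsq : (γ * m) ^ 2 ≤ s := by nlinarith [mul_nonneg hγ.le (sq_nonneg (m : ℝ))]
  by_cases hbig : 4 ≤ m ∧ 4 ≤ s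
  -- `q` rows would fit both into the classes and into the sparsity budget; `K + 1` is the largest
  -- power of two up to `q`, hence more than `q / 2`.
  · set q := min (m / 2) (Nat.sqrt s) with hq
    have hq2 : 2 ≤ q := le_min (by omega) (Nat.le_sqrt.2 (by omega))
    set t := Nat.log 2 q with ht
    have h1 : 2 ^ t ≤ q := Nat.pow_log_le_self 2 (by omega)
    have h2 : q < 2 ^ (t + 1) := Nat.lt_pow_succ_log_self one_lt_two q
    have ht1 : 1 ≤ t := Nat.log_pos one_lt_two hq2
    have h3 : 2 ≤ 2 ^ t := by
      calc 2 = 2 ^ 1 := by norm_num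
        _ ≤ 2 ^ t := Nat.pow_le_pow_right two_pos ht1
    obtain ⟨K, hK⟩ : ∃ K, K + 1 = 2 ^ t := ⟨2 ^ t - 1, by omega⟩
    have hqm : q ≤ m / 2 := min_le_left _ _
    have hqs : q ≤ Nat.sqrt s := min_le_right _ _
    refine ⟨K, by omega, ?_, exists_of_pow hK (by omega) ?_ hn⟩
    · have h4 : q + 1 ≤ 2 * (K + 1) := by
        rw [pow_succ] at h2
        omega
      have h4' : (q : ℝ) + 1 ≤ 2 * (K + 1) := by exact_mod_cast h4
      refine le_trans ?_ h4'
      rcases min_choice (m / 2) (Nat.sqrt s) with h | h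
      · have h5 : m ≤ 2 * (q + 1) := by omega
        have h5' : (m : ℝ) ≤ 2 * (q + 1) := by exact_mod_cast h5
        nlinarith
      · have h5 : s < (q + 1) ^ 2 := by
          rw [hq, h, pow_two]
          exact Nat.lt_succ_sqrt s
        have h5' : (s : ℝ) < (q + 1) ^ 2 := by exact_mod_cast h5
        exact (abs_le_of_sq_le_sq' (hsq.trans h5'.le) (by positivity)).2
    · calc (K + 1) ^ 2 ≤ Nat.sqrt s ^ 2 := Nat.pow_le_pow_left (by omega) 2
        _ ≤ s := Nat.sqrt_le' s
  · refine ⟨1, le_rfl, ?_, ?_⟩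
    · rw [not_and_or, not_le, not_le] at hbig
      rcases hbig with h | h
      · have : (m : ℝ) < 4 := by exact_mod_cast h
        push_cast
        nlinarith
      · have : (s : ℝ) < 4 := by exact_mod_cast h
        push_cast
        nlinarith
    · rcases Nat.lt_or_ge m 3 with h | h
      · obtain rfl : m = 2 := by omega
        exact exists_of_two (by omega)
      · exact exists_of_three_le h hs

end Pattern

end DSBM

/-! ### Lower bounds for constant clusterings and for class changes -/

namespace DSBM

namespace Pattern

variable {m n K L s n₀ : ℕ} (P : Pattern m n K)

/-- The lower bound for the estimation of clusterings that do not change with time. -/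
theorem exists_quarter_le_law_const (hn : 2 * m ≤ n) (hn0 : 2 ≤ n) (hL : 0 < L) (hK : 1 ≤ K)
    {H : Matrix (Fin L) (Fin L) ℝ} (hH : H ∈ Matrix.orthogonalGroup (Fin L) ℝ)
    (hT : TransformCondition H) (hs : (Finset.univ.filter fun p => P.supp p = true).card ≤ s)
    (est : Observation n L → Fin n → Fin n → Fin L → ℝ) :
    ∃ G ∈ sparseTensors m L s H, ∃ z ∈ clusterings m n n₀ L, (1 / 4 : ℝ≥0∞) ≤
      law (connProb G z) {a | Real.log (K + 1 : ℕ) * (n / 2 : ℕ) / 768000 ≤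
        sqDist (est a) (connProb G z)} := by
  have hham : ∀ θ θ' : Fin (n / 2) → Fin (K + 1),
      hammingDist (fun x : Fin L × Fin (n / 2) => θ x.2) (fun x => θ' x.2) =
        L * hammingDist θ θ' := by
    intro θ θ'
    have h1 : (Finset.univ.filter fun x : Fin L × Fin (n / 2) => θ x.2 ≠ θ' x.2) =
        Finset.univ ×ˢ (Finset.univ.filter fun i => θ i ≠ θ' i) := by
      ext
      simp
    rw [hammingDist, h1, Finset.card_product, Finset.card_univ, Fintype.card_fin, hammingDist]
  have : Nonempty (Fin (n / 2)) := ⟨⟨0, by omega⟩⟩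
  -- One letter governs a node at all times, so it accounts for `c = L` row numbers.
  have h := P.exists_quarter_le_law (by omega) hL hH hT hs (A := Fin (K + 1)) (B := Fin (n / 2))
    (n₀ := n₀) (by simpa using hK) 0 (fun θ x => θ x.2) hL (fun θ θ' => (hham θ θ').ge)
    (fun θ b => by
      rw [hham]
      nlinarith [hammingDist_update_le_one θ b 0]) (fun θ => by
      intro l l' _
      have : ∀ i, P.assign (fun x : Fin L × Fin (n / 2) => θ x.2) l' i =
          P.assign (fun x : Fin L × Fin (n / 2) => θ x.2) l i := fun i => rfl
      simp [this]) (by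
      have h1 : K + 1 ≤ n := (P.card_le (by omega)).trans (by omega)
      have h2 : ((K + 1 : ℕ) : ℝ) ≤ n := by exact_mod_cast h1
      have h3 := Real.log_le_self (Nat.cast_nonneg (α := ℝ) (K + 1))
      have h4 : (1 : ℝ) ≤ L := by exact_mod_cast hL
      rw [Fintype.card_fin]
      nlinarith [Nat.cast_nonneg (α := ℝ) n]) est
  simpa only [Fintype.card_fin] using h

/-- The row number of the `x`-th node of a block in which the given choice has been made: at most
one node is moved to a nonzero row. -/
def moved {β : ℕ} (a : Option (Fin β × Fin K)) (x : Fin β) : Fin (K + 1) :=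
  match a with
  | none => 0
  | some (y, k) => if y = x then k.succ else 0

lemma exists_moved_ne {β : ℕ} {a a' : Option (Fin β × Fin K)} (h : a ≠ a') :
    ∃ x, moved a x ≠ moved a' x := by
  rcases a with _ | ⟨y, k⟩ <;> rcases a' with _ | ⟨y', k'⟩
  · exact absurd rfl h
  · exact ⟨y', by simpa [moved] using (Fin.succ_ne_zero k').symm⟩
  · exact ⟨y, by simp [moved]⟩
  · refine ⟨y, ?_⟩
    by_cases hy : y' = y
    · subst hy
      have : k ≠ k' := fun hk => h (by rw [hk])
      simpa [moved] using this
    · simp [moved, hy]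

/-- The position of the `x`-th node of a block: the blocks belong to the even times. -/
def position {L n n₀ β : ℕ} (h : n₀ * β ≤ n) (y : (Fin ((L + 1) / 2) × Fin n₀) × Fin β) :
    Fin L × Fin n :=
  (⟨2 * y.1.1, by omega⟩, (finProdFinEquiv (y.1.2, y.2)).castLE h)

lemma position_injective {L n n₀ β : ℕ} (h : n₀ * β ≤ n) :
    Function.Injective (position (L := L) h) := by
  rintro ⟨⟨τ, b⟩, x⟩ ⟨⟨τ', b'⟩, x'⟩ he
  simp only [position, Prod.mk.injEq, Fin.mk.injEq] at he
  have h1 := finProdFinEquiv.injective (Fin.castLE_injective h he.2)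
  simp only [Prod.mk.injEq] at h1
  simp only [Prod.mk.injEq]
  exact ⟨⟨Fin.ext (by omega), h1.1⟩, h1.2⟩

/-- The row numbers of all nodes at all times, for given choices in all blocks. -/
noncomputable def blockRows {L n n₀ β : ℕ} (h : n₀ * β ≤ n)
    (θ : Fin ((L + 1) / 2) × Fin n₀ → Option (Fin β × Fin K)) : Fin L × Fin n → Fin (K + 1) :=
  Function.extend (position h) (fun y => moved (θ y.1) y.2) fun _ => 0

lemma blockRows_position {L n n₀ β : ℕ} (h : n₀ * β ≤ n)
    (θ : Fin ((L + 1) / 2) × Fin n₀ → Option (Fin β × Fin K))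
    (y : (Fin ((L + 1) / 2) × Fin n₀) × Fin β) :
    blockRows h θ (position h y) = moved (θ y.1) y.2 :=
  (position_injective h).extend_apply _ _ _

lemma exists_position_of_ne {L n n₀ β : ℕ} (h : n₀ * β ≤ n)
    (θ : Fin ((L + 1) / 2) × Fin n₀ → Option (Fin β × Fin K)) {v : Fin L × Fin n}
    (hv : blockRows h θ v ≠ 0) :
    ∃ b x k, θ b = some (x, k) ∧ v = position h (b, x) := by
  by_cases he : ∃ y, position h y = v
  · obtain ⟨⟨b, x⟩, rfl⟩ := he
    rw [blockRows_position] at hv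
    cases hθ : θ b with
    | none => simp [moved, hθ] at hv
    | some a =>
      obtain ⟨y, k⟩ := a
      by_cases hy : y = x
      · subst hy
        exact ⟨b, y, k, hθ, rfl⟩
      · simp [moved, hθ, hy] at hv
  · exact absurd (Function.extend_apply' _ _ _ he) hv

lemma hammingDist_le_blockRows {L n n₀ β : ℕ} (hβ : 0 < β) (h : n₀ * β ≤ n)
    (θ θ' : Fin ((L + 1) / 2) × Fin n₀ → Option (Fin β × Fin K)) :
    hammingDist θ θ' ≤ hammingDist (blockRows h θ) (blockRows h θ') := by
  have hx : ∀ b, ∃ y : (Fin ((L + 1) / 2) × Fin n₀) × Fin β, θ b ≠ θ' b →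
      y.1 = b ∧ blockRows h θ (position h y) ≠ blockRows h θ' (position h y) := by
    intro b
    by_cases hb : θ b = θ' b
    · exact ⟨(b, ⟨0, hβ⟩), fun h => absurd hb h⟩
    · obtain ⟨x, hx⟩ := exists_moved_ne hb
      exact ⟨(b, x), fun _ => ⟨rfl, by rwa [blockRows_position, blockRows_position]⟩⟩
  choose y hy using hx
  refine Finset.card_le_card_of_injOn (fun b => position h (y b)) ?_ ?_
  · intro b hb
    simpa using (hy b (by simpa using hb)).2
  · intro b hb b' hb' he
    have := congrArg Prod.fst (position_injective h he)
    rwa [(hy b (by simpa using hb)).1, (hy b' (by simpa using hb')).1] at this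

lemma hammingDist_blockRows_update_le {L n n₀ β : ℕ} (h : n₀ * β ≤ n)
    (θ : Fin ((L + 1) / 2) × Fin n₀ → Option (Fin β × Fin K)) (b : Fin ((L + 1) / 2) × Fin n₀) :
    hammingDist (blockRows h θ) (blockRows h (Function.update θ b none)) ≤ 1 := by
  have key : ∀ v, blockRows h θ v ≠ blockRows h (Function.update θ b none) v →
      ∃ x k, θ b = some (x, k) ∧ v = position h (b, x) := by
    intro v hv
    have h1 : blockRows h θ v ≠ 0 := by
      intro h0
      rw [h0] at hv
      obtain ⟨b', x, k, hb', rfl⟩ := exists_position_of_ne h _ hv.symm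
      by_cases hbb : b' = b
      · subst hbb
        simp at hb'
      · rw [blockRows_position] at h0
        rw [Function.update_of_ne hbb] at hb'
        simp [moved, hb'] at h0
    obtain ⟨b', x, k, hb', rfl⟩ := exists_position_of_ne h _ h1
    by_cases hbb : b' = b
    · subst hbb
      exact ⟨x, k, hb', rfl⟩
    · rw [blockRows_position, blockRows_position, Function.update_of_ne hbb] at hv
      exact absurd rfl hv
  refine Finset.card_le_one.2 fun v hv v' hv' => ?_
  obtain ⟨x, k, h1, rfl⟩ := key v (by simpa using hv)
  obtain ⟨x', k', h1', rfl⟩ := key v' (by simpa using hv')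
  rw [h1] at h1'
  simp only [Option.some.injEq, Prod.mk.injEq] at h1'
  rw [h1'.1]

lemma ncard_blockRows_ne_zero_le {L n n₀ β : ℕ} (h : n₀ * β ≤ n)
    (θ : Fin ((L + 1) / 2) × Fin n₀ → Option (Fin β × Fin K)) (l : Fin L) :
    {i | blockRows h θ (l, i) ≠ 0}.ncard ≤ n₀ := by
  have hinj : Set.ncard {i | blockRows h θ (l, i) ≠ 0} ≤ Set.ncard (Set.univ : Set (Fin n₀)) := by
    have hb : ∀ i ∈ {i | blockRows h θ (l, i) ≠ 0}, ∃ b x k, θ b = some (x, k) ∧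
        (l, i) = position h (b, x) := fun i hi => exists_position_of_ne h θ hi
    rcases Set.eq_empty_or_nonempty {i | blockRows h θ (l, i) ≠ 0} with he | ⟨i₀, hi₀⟩
    · simp [he]
    obtain ⟨b₀, x₀, k₀, -⟩ := hb i₀ hi₀
    have : Nonempty (Fin ((L + 1) / 2) × Fin n₀) := ⟨b₀⟩
    have : Nonempty (Fin β) := ⟨x₀⟩
    have : Nonempty (Fin K) := ⟨k₀⟩
    choose! b x k hb using hb
    refine Set.ncard_le_ncard_of_injOn (fun i => (b i).2) (fun _ _ => Set.mem_univ _) ?_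
    intro i hi i' hi' he
    obtain ⟨h1, h2⟩ := hb i hi
    obtain ⟨h1', h2'⟩ := hb i' hi'
    have h3 : (b i).1 = (b i').1 := by
      have e1 := congrArg (fun v => (v.1 : ℕ)) h2
      have e2 := congrArg (fun v => (v.1 : ℕ)) h2'
      simp only [position] at e1 e2
      exact Fin.ext (by omega)
    have h4 : b i = b i' := Prod.ext h3 he
    have h5 : x i = x i' := by
      rw [h4, h1'] at h1
      simp only [Option.some.injEq, Prod.mk.injEq] at h1
      exact h1.1.symm
    rw [h4, h5, ← h2'] at h2
    exact (Prod.mk.inj h2).2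
  simpa using hinj

lemma blockRows_of_odd {L n n₀ β : ℕ} (h : n₀ * β ≤ n)
    (θ : Fin ((L + 1) / 2) × Fin n₀ → Option (Fin β × Fin K)) {l : Fin L} (hl : (l : ℕ) % 2 = 1)
    (i : Fin n) : blockRows h θ (l, i) = 0 := by
  by_contra hne
  obtain ⟨b, x, k, -, h1⟩ := exists_position_of_ne h θ hne
  have := congrArg (fun v => (v.1 : ℕ)) h1
  simp only [position] at this
  omega

lemma assign_blockRows_mem {β : ℕ} (h : n₀ * β ≤ n / 2)
    (θ : Fin ((L + 1) / 2) × Fin n₀ → Option (Fin β × Fin K)) :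
    P.assign (blockRows h θ) ∈ clusterings m n n₀ L := by
  -- `l₀` stands for the even one of two consecutive times. All free nodes are in row `0` at the odd
  -- one, so only the at most `n₀` nodes moved at `l₀` change class.
  have key : ∀ l₀ l₁ l₂ : Fin L, (∀ i, blockRows h θ (l₁, i) ≠ blockRows h θ (l₂, i) →
      blockRows h θ (l₀, i) ≠ 0) →
      {i | P.assign (blockRows h θ) l₁ i ≠ P.assign (blockRows h θ) l₂ i}.ncard ≤ n₀ := by
    intro l₀ l₁ l₂ hl
    refine le_trans ?_ (ncard_blockRows_ne_zero_le h θ l₀)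
    refine le_trans (Set.ncard_le_ncard (t := Fin.castLE (Nat.div_le_self n 2) ''
      {i | blockRows h θ (l₀, i) ≠ 0}) ?_ (Set.toFinite _)) (Set.ncard_image_le (Set.toFinite _))
    intro i hi
    by_cases hin : (i : ℕ) < n / 2
    · refine ⟨⟨i, hin⟩, hl _ fun he => hi ?_, rfl⟩
      simp only [assign, hin, dif_pos]
      rw [he]
    · exact absurd (by simp [assign, hin]) hi
  intro l l' hl
  rcases Nat.mod_two_eq_zero_or_one (l : ℕ) with hl0 | hl1
  · refine key l l' l fun i hi h0 => hi ?_
    rw [h0, blockRows_of_odd h θ (by omega)]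
  · refine key l' l' l fun i hi h0 => hi ?_
    rw [h0, blockRows_of_odd h θ hl1]

/-- The lower bound for the estimation of the class changes. -/
theorem exists_quarter_le_law_moved (hn : 2 * m ≤ n) (hn0 : 2 ≤ n) (hL : 0 < L) (hK : 1 ≤ K)
    (hn₀ : 1 ≤ n₀) (hn₀n : n₀ ≤ n / 2)
    {H : Matrix (Fin L) (Fin L) ℝ} (hH : H ∈ Matrix.orthogonalGroup (Fin L) ℝ)
    (hT : TransformCondition H) (hs : (Finset.univ.filter fun p => P.supp p = true).card ≤ s)
    (est : Observation n L → Fin n → Fin n → Fin L → ℝ) :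
    ∃ G ∈ sparseTensors m L s H, ∃ z ∈ clusterings m n n₀ L, (1 / 4 : ℝ≥0∞) ≤
      law (connProb G z) {a | Real.log ((n / 2) / n₀ * K + 1 : ℕ) *
        ((L + 1) / 2 * n₀ : ℕ) / 768000 ≤ sqDist (est a) (connProb G z)} := by
  -- `n₀` disjoint blocks of this size fit into the free half of the nodes. A block has `β * K + 1`
  -- choices: no move, or one of `β` nodes sent to one of `K` nonzero rows.
  set β := (n / 2) / n₀ with hβ
  have hβ1 : 1 ≤ β := Nat.div_pos hn₀n hn₀
  have hpos : n₀ * β ≤ n / 2 := Nat.mul_div_le _ _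
  have hcard : Fintype.card (Option (Fin β × Fin K)) = β * K + 1 := by simp
  have : Nonempty (Fin ((L + 1) / 2) × Fin n₀) := ⟨(⟨0, by omega⟩, ⟨0, by omega⟩)⟩
  have h := P.exists_quarter_le_law (by omega) hL hH hT hs (A := Option (Fin β × Fin K))
    (B := Fin ((L + 1) / 2) × Fin n₀) (n₀ := n₀) (by rw [hcard]; nlinarith) none (blockRows hpos)
    (c := 1) one_pos (fun θ θ' => by simpa using hammingDist_le_blockRows hβ1 hpos θ θ')
    (hammingDist_blockRows_update_le hpos) (P.assign_blockRows_mem hpos) (by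
      rw [hcard]
      have h1 : K + 1 ≤ n := (P.card_le (by omega)).trans (by omega)
      have h2 : β ≤ n := (Nat.div_le_self _ _).trans (Nat.div_le_self _ _)
      have h3 : β * K + 1 ≤ n * n := by nlinarith
      have h3' : ((β * K + 1 : ℕ) : ℝ) ≤ n * n := by exact_mod_cast h3
      have h4 : (0 : ℝ) < n := by positivity
      have h5 : Real.log (β * K + 1 : ℕ) ≤ Real.log (n * n) :=
        Real.log_le_log (by positivity) h3'
      rw [Real.log_mul h4.ne' h4.ne'] at h5
      have h6 := Real.log_le_self h4.le
      push_cast at h5 ⊢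
      linarith) est
  simpa only [hcard, Fintype.card_prod, Fintype.card_fin] using h

end Pattern

end DSBM

/-! ### Connectivity hypotheses with a balanced clustering -/

namespace DSBM

variable {m n L s n₀ : ℕ}

/-- The balanced clustering. -/
def cyclicClass (n : ℕ) (hm : 0 < m) (i : Fin n) : Fin m := ⟨i % m, Nat.mod_lt _ hm⟩

/-- The ordered pairs of distinct nodes with a given unordered pair of classes. -/
def classFiber (n : ℕ) (hm : 0 < m) (p : ClassPair m) : Finset (Fin n × Fin n) :=
  Finset.univ.filter fun x => x.1 ≠ x.2 ∧ symPair (cyclicClass n hm x.1) (cyclicClass n hm x.2) = p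

lemma card_cyclicClass_le (hm : 0 < m) (k : Fin m) :
    (Finset.univ.filter fun i => cyclicClass n hm i = k).card ≤ n / m + 1 := by
  refine (Finset.card_le_card_of_injOn (t := Finset.range (n / m + 1))
    (fun i : Fin n => (i : ℕ) / m) ?_ ?_).trans (by simp)
  · intro i _
    simp only [Finset.coe_range, Set.mem_Iio]
    exact Nat.lt_succ_of_le (Nat.div_le_div_right i.2.le)
  · intro i hi j hj h
    have h1 : (i : ℕ) % m = k := congrArg Fin.val (Finset.mem_filter.1 hi).2
    have h2 : (j : ℕ) % m = k := congrArg Fin.val (Finset.mem_filter.1 hj).2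
    have h3 : (i : ℕ) / m = j / m := h
    refine Fin.ext ?_
    rw [← Nat.div_add_mod (i : ℕ) m, ← Nat.div_add_mod (j : ℕ) m, h1, h2, h3]

lemma card_classFiber_le (hm : 0 < m) (p : ClassPair m) :
    (classFiber n hm p).card ≤ 2 * (n / m + 1) ^ 2 := by
  set S : Fin m → Finset (Fin n) := fun k => Finset.univ.filter fun i => cyclicClass n hm i = k
  have h1 : classFiber n hm p ⊆ (S p.1.1 ×ˢ S p.1.2) ∪ (S p.1.2 ×ˢ S p.1.1) := by
    rintro ⟨i, j⟩ hx
    have h2 := (Finset.mem_filter.1 hx).2.2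
    simp only [S, Finset.mem_union, Finset.mem_product, Finset.mem_filter, Finset.mem_univ,
      true_and]
    rw [← h2]
    rcases le_total (cyclicClass n hm i) (cyclicClass n hm j) with h | h <;> simp [symPair, h]
  have h2 : ∀ k k', (S k ×ˢ S k').card ≤ (n / m + 1) ^ 2 := fun k k' => by
    rw [Finset.card_product, pow_two]
    exact Nat.mul_le_mul (card_cyclicClass_le hm k) (card_cyclicClass_le hm k')
  have h3 := (Finset.card_le_card h1).trans (Finset.card_union_le _ _)
  have h4 := h2 p.1.1 p.1.2
  have h5 := h2 p.1.2 p.1.1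
  omega

/-- The two nodes are taken from disjoint ranges of cycles, the first `h` and the next `h`. They are
then distinct even when the two classes coincide. -/
lemma le_card_classFiber (hm : 0 < m) (p : ClassPair m) :
    (n / (2 * m)) ^ 2 ≤ (classFiber n hm p).card := by
  set h := n / (2 * m) with hh
  have h0 : 2 * m * h ≤ n := Nat.mul_div_le _ _
  have hlt : ∀ (k : Fin m) (a : ℕ), a < 2 * h → k + m * a < n := by
    intro k a ha
    have h1 : m * (a + 1) ≤ m * (2 * h) := Nat.mul_le_mul_left _ ha
    have := k.2
    nlinarith
  have h1 : h ^ 2 = (Finset.univ : Finset (Fin h × Fin h)).card := by simp [pow_two]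
  rw [h1]
  refine Finset.card_le_card_of_injOn (fun x => (⟨p.1.1 + m * x.1, hlt _ _ (by omega)⟩,
    ⟨p.1.2 + m * (h + x.2), hlt _ _ (by omega)⟩)) ?_ ?_
  · rintro ⟨a, b⟩ -
    have hc : ∀ (k : Fin m) (a : ℕ), (k + m * a) % m = k := fun k a => by
      rw [Nat.add_mul_mod_self_left, Nat.mod_eq_of_lt k.2]
    refine Finset.mem_coe.2 (Finset.mem_filter.2 ⟨Finset.mem_univ _, ?_⟩)
    simp only [cyclicClass, hc, ne_eq, Fin.mk.injEq]
    refine ⟨?_, symPair_of_le p.2⟩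
    have h2 : m * ((a : ℕ) + 1) ≤ m * h := Nat.mul_le_mul_left _ a.2
    have := p.1.1.2
    have h3 : 0 ≤ m * (b : ℕ) := Nat.zero_le _
    rw [Nat.mul_add] at *
    omega
  · rintro ⟨a, b⟩ - ⟨a', b'⟩ - he
    simp only [Prod.mk.injEq, Fin.mk.injEq, Nat.add_left_cancel_iff,
      Nat.mul_left_cancel_iff hm] at he
    exact Prod.ext (Fin.ext he.1) (Fin.ext he.2)

/-- Grouping the node pairs by their class pair turns the distance of tensors into a weighted
distance of connectivities, with weights of order `n² / m²`. -/
lemma sqDist_cyclicClass (hm : 0 < m) (Q Q' : ClassPair m → Fin L → I) :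
    sqDist (fun i j l => (connProb (symTensor Q) (fun _ => cyclicClass n hm) i j l : ℝ))
      (connProb (symTensor Q') (fun _ => cyclicClass n hm)) =
    ∑ p, (classFiber n hm p).card * ∑ l, ((Q p l : ℝ) - Q' p l) ^ 2 := by
  have h1 : ∀ p, (classFiber n hm p).card * ∑ l, ((Q p l : ℝ) - Q' p l) ^ 2 =
      ∑ x : Fin n × Fin n with symPair (cyclicClass n hm x.1) (cyclicClass n hm x.2) = p,
        if x.1 ≠ x.2 then ∑ l, ((Q p l : ℝ) - Q' p l) ^ 2 else 0 := by
    intro p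
    rw [← Finset.sum_filter, Finset.filter_filter, Finset.sum_const, nsmul_eq_mul, classFiber]
    simp only [and_comm]
  have h2 : ∀ p, (∑ x : Fin n × Fin n with
      symPair (cyclicClass n hm x.1) (cyclicClass n hm x.2) = p,
        if x.1 ≠ x.2 then ∑ l, ((Q p l : ℝ) - Q' p l) ^ 2 else 0) =
      ∑ x : Fin n × Fin n with symPair (cyclicClass n hm x.1) (cyclicClass n hm x.2) = p,
        ∑ l, ((connProb (symTensor Q) (fun _ => cyclicClass n hm) x.1 x.2 l : ℝ) -
          connProb (symTensor Q') (fun _ => cyclicClass n hm) x.1 x.2 l) ^ 2 := by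
    intro p
    refine Finset.sum_congr rfl fun x hx => ?_
    rw [← (Finset.mem_filter.1 hx).2]
    by_cases h : x.1 = x.2
    · simp [connProb, h]
    · simp [connProb, h, symTensor]
  simp only [h1, h2]
  rw [Finset.sum_fiberwise, sqDist, Fintype.sum_prod_type]

/-- The lower bound that results from a product family of connectivities. -/
theorem exists_quarter_le_law_connectivity (hm : 0 < m) (hn : 2 * m ≤ n)
    {H : Matrix (Fin L) (Fin L) ℝ}
    {A B : Type*} [Fintype A] [Fintype B] [DecidableEq A] [DecidableEq B]
    [Nonempty B] (hA : 2 ≤ Fintype.card A) (a₀ : A) (Q : (B → A) → ClassPair m → Fin L → I)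
    {E : ℝ} (hE0 : 0 ≤ E) (hE : 4800 * n ^ 2 * E ≤ m ^ 2 * Real.log (Fintype.card A))
    (hsep : ∀ θ θ', E * hammingDist θ θ' ≤ ∑ p, ∑ l, ((Q θ p l : ℝ) - Q θ' p l) ^ 2)
    (hclose : ∀ θ b, ∑ p, ∑ l, ((Q θ p l : ℝ) - Q (Function.update θ b a₀) p l) ^ 2 ≤ E)
    (hcomp : ∀ θ θ' p l, Q θ p l = Q θ' p l ∨ (Q θ' p l : ℝ) ∈ Set.Icc (1 / 4) (3 / 4))
    (hmem : ∀ θ, symTensor (Q θ) ∈ sparseTensors m L s H)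
    (est : Observation n L → Fin n → Fin n → Fin L → ℝ) :
    ∃ G ∈ sparseTensors m L s H, ∃ z ∈ clusterings m n n₀ L, (1 / 4 : ℝ≥0∞) ≤
      law (connProb G z) {a | n ^ 2 / m ^ 2 * E * Fintype.card B / 1280 ≤
        sqDist (est a) (connProb G z)} := by
  have hm0 : (0 : ℝ) < m := by exact_mod_cast hm
  have hlow : ∀ p : ClassPair m, (n : ℝ) ^ 2 / (16 * m ^ 2) ≤ (classFiber n hm p).card := by
    intro p
    have h1 : (((n / (2 * m) : ℕ) : ℝ)) ^ 2 ≤ (classFiber n hm p).card := by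
      exact_mod_cast le_card_classFiber hm p
    have h2 : n ≤ 4 * m * (n / (2 * m)) := by
      have h3 := Nat.lt_mul_div_succ n (by omega : 0 < 2 * m)
      have h4 : 1 ≤ n / (2 * m) := Nat.div_pos hn (by omega)
      nlinarith
    have h2' : (n : ℝ) ≤ 4 * m * (n / (2 * m) : ℕ) := by exact_mod_cast h2
    refine le_trans ?_ h1
    rw [div_le_iff₀ (by positivity)]
    calc (n : ℝ) ^ 2 ≤ (4 * m * (n / (2 * m) : ℕ)) ^ 2 := by gcongr
      _ = _ := by ring
  have hup : ∀ p : ClassPair m, ((classFiber n hm p).card : ℝ) ≤ 8 * n ^ 2 / m ^ 2 := by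
    intro p
    have h1 : ((classFiber n hm p).card : ℝ) ≤ 2 * ((n / m + 1 : ℕ) : ℝ) ^ 2 := by
      exact_mod_cast card_classFiber_le hm p
    have h2 : m * (n / m + 1) ≤ 2 * n := by
      have := Nat.mul_div_le n m
      rw [Nat.mul_add]
      omega
    have h2' : (m : ℝ) * (n / m + 1 : ℕ) ≤ 2 * n := by exact_mod_cast h2
    refine h1.trans ?_
    rw [le_div_iff₀ (by positivity)]
    calc 2 * ((n / m + 1 : ℕ) : ℝ) ^ 2 * (m : ℝ) ^ 2 =
        2 * ((m : ℝ) * (n / m + 1 : ℕ)) ^ 2 := by ring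
      _ ≤ 2 * (2 * (n : ℝ)) ^ 2 := by gcongr
      _ = _ := by ring
  -- The lower weight gives the separation `r`, with `16 * 80 = 1280`; the upper weight gives the
  -- closeness, with `600 * 8 = 4800`.
  obtain ⟨θ, hθ⟩ := exists_quarter_le_law hA a₀
    (fun θ => connProb (symTensor (Q θ)) (fun _ => cyclicClass n hm))
    (r := n ^ 2 / (16 * m ^ 2) * E) (by positivity) (fun θ θ' => by
      rw [sqDist_cyclicClass, mul_assoc]
      refine (mul_le_mul_of_nonneg_left (hsep θ θ') (by positivity)).trans ?_
      rw [Finset.mul_sum]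
      exact Finset.sum_le_sum fun p _ => mul_le_mul_of_nonneg_right (hlow p)
        (Finset.sum_nonneg fun _ _ => sq_nonneg _)) (fun θ b => by
      have h1 : sqDist (fun i j l => (connProb (symTensor (Q θ))
          (fun _ => cyclicClass n hm) i j l : ℝ)) (connProb
          (symTensor (Q (Function.update θ b a₀))) (fun _ => cyclicClass n hm)) ≤
          8 * n ^ 2 / m ^ 2 * E := by
        rw [sqDist_cyclicClass]
        refine le_trans ?_ (mul_le_mul_of_nonneg_left (hclose θ b) (by positivity))
        rw [Finset.mul_sum]
        exact Finset.sum_le_sum fun p _ => mul_le_mul_of_nonneg_right (hup p)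
          (Finset.sum_nonneg fun _ _ => sq_nonneg _)
      have h2 : 600 * (8 * n ^ 2 / m ^ 2 * E) = 4800 * n ^ 2 * E / m ^ 2 := by ring
      refine (mul_le_mul_of_nonneg_left h1 (by norm_num)).trans ?_
      rw [h2, div_le_iff₀ (by positivity)]
      linarith) (fun θ b i j l => by
      by_cases h : i = j
      · left
        simp [connProb, h]
      · simpa [connProb, h, symTensor] using hcomp θ _ _ l) est
  refine ⟨_, hmem θ, fun _ => cyclicClass n hm, fun l l' _ => by simp, le_of_le_of_eq hθ ?_⟩
  have : (n : ℝ) ^ 2 / (16 * m ^ 2) * E * Fintype.card B / 80 =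
      n ^ 2 / m ^ 2 * E * Fintype.card B / 1280 := by
    field_simp
    ring
  simp only [this]

/-- The extension by zero of connection probabilities that are given for some pairs of classes. -/
noncomputable def extendZero (P : Finset (ClassPair m))
    (q : P → Fin L → Set.Icc (1 / 4 : ℝ) (3 / 4)) (p : ClassPair m) (l : Fin L) : I :=
  if h : p ∈ P then ⟨q ⟨p, h⟩ l, by
    have := (q ⟨p, h⟩ l).2.1
    have := (q ⟨p, h⟩ l).2.2
    constructor <;> linarith⟩ else 0

lemma extendZero_coe (P : Finset (ClassPair m))
    (q : P → Fin L → Set.Icc (1 / 4 : ℝ) (3 / 4)) (p : P) (l : Fin L) :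
    (extendZero P q p l : ℝ) = q p l := by
  simp [extendZero]

lemma extendZero_of_notMem (P : Finset (ClassPair m))
    (q : P → Fin L → Set.Icc (1 / 4 : ℝ) (3 / 4)) {p : ClassPair m} (hp : p ∉ P) (l : Fin L) :
    extendZero P q p l = 0 := by
  simp [extendZero, hp]

lemma extendZero_eq_or (P : Finset (ClassPair m))
    (q q' : P → Fin L → Set.Icc (1 / 4 : ℝ) (3 / 4)) (p : ClassPair m) (l : Fin L) :
    extendZero P q p l = extendZero P q' p l ∨
      (extendZero P q' p l : ℝ) ∈ Set.Icc (1 / 4) (3 / 4) := by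
  by_cases hp : p ∈ P
  · right
    rw [show p = ((⟨p, hp⟩ : P) : ClassPair m) from rfl, extendZero_coe]
    exact (q' _ l).2
  · left
    rw [extendZero_of_notMem P q hp, extendZero_of_notMem P q' hp]

lemma sum_extendZero (P : Finset (ClassPair m))
    (q q' : P → Fin L → Set.Icc (1 / 4 : ℝ) (3 / 4)) :
    ∑ p, ∑ l, ((extendZero P q p l : ℝ) - extendZero P q' p l) ^ 2 =
      ∑ p, ∑ l, ((q p l : ℝ) - q' p l) ^ 2 := by
  refine (Finset.sum_of_injOn Subtype.val Subtype.val_injective.injOn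
    (fun _ _ => Finset.mem_coe.2 (Finset.mem_univ _)) (fun p _ hp => ?_) fun p _ => ?_).symm
  · have : p ∉ P := fun h => hp ⟨⟨p, h⟩, by simp, rfl⟩
    simp [extendZero_of_notMem P _ this]
  · simp only [extendZero_coe]

/-- The lower bound for connectivities that are unrestricted for some pairs of classes. -/
theorem exists_quarter_le_law_dense (hm : 0 < m) (hn : 2 * m ≤ n) (hL : 0 < L)
    {H : Matrix (Fin L) (Fin L) ℝ} (hH : H ∈ Matrix.orthogonalGroup (Fin L) ℝ)
    {P : Finset (ClassPair m)} (hP0 : P.Nonempty) (hP : L * P.card ≤ s)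
    (est : Observation n L → Fin n → Fin n → Fin L → ℝ) :
    ∃ G ∈ sparseTensors m L s H, ∃ z ∈ clusterings m n n₀ L, (1 / 4 : ℝ≥0∞) ≤
      law (connProb G z) {a | Real.log 2 * (P.card * L) / 6144000 ≤
        sqDist (est a) (connProb G z)} := by
  have hm0 : (0 : ℝ) < m := by exact_mod_cast hm
  have hn0 : (0 : ℝ) < n := by exact_mod_cast (by omega : 0 < n)
  have hmn : (m : ℝ) ≤ n := by exact_mod_cast (by omega : m ≤ n)
  have hlog : 0 ≤ Real.log 2 := Real.log_nonneg (by norm_num)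
  have hlog1 : Real.log 2 ≤ 1 := by linarith [Real.log_two_lt_d9]
  -- The value that makes the closeness condition an equality for a binary alphabet.
  set x := (m : ℝ) ^ 2 * Real.log 2 / (4800 * n ^ 2) with hx
  have hx0 : 0 ≤ x := by positivity
  have hx1 : x ≤ (1 / 4) ^ 2 := by
    rw [hx, div_le_iff₀ (by positivity)]
    have : (m : ℝ) ^ 2 ≤ n ^ 2 := by gcongr
    nlinarith
  have hε : √x ≤ 1 / 4 := Real.sqrt_le_iff.2 ⟨by norm_num, hx1⟩
  let q : (P × Fin L → Bool) → P → Fin L → Set.Icc (1 / 4 : ℝ) (3 / 4) := fun θ p l =>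
    ⟨1 / 2 + if θ (p, l) then √x else 0, by
      have := Real.sqrt_nonneg x
      split_ifs <;> constructor <;> linarith⟩
  have hham : ∀ θ θ', ∑ p, ∑ l, ((q θ p l : ℝ) - q θ' p l) ^ 2 = x * hammingDist θ θ' := by
    intro θ θ'
    rw [hammingDist, Finset.card_filter, Nat.cast_sum, Fintype.sum_prod_type, Finset.mul_sum]
    refine Finset.sum_congr rfl fun p _ => ?_
    rw [Finset.mul_sum]
    refine Finset.sum_congr rfl fun l _ => ?_
    simp only [q]
    cases θ (p, l) <;> cases θ' (p, l) <;> simp [Real.sq_sqrt hx0]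
  have : Nonempty (P × Fin L) := ⟨(⟨_, hP0.choose_spec⟩, ⟨0, hL⟩)⟩
  have h := exists_quarter_le_law_connectivity (n₀ := n₀) hm hn (A := Bool) (B := P × Fin L)
    (by simp) false (fun θ => extendZero P (q θ)) hx0 (by
      rw [hx, Fintype.card_bool, Nat.cast_ofNat]
      field_simp
      exact le_rfl) (fun θ θ' => by rw [sum_extendZero, hham]) (fun θ b => by
      rw [sum_extendZero, hham]
      have h2 : (hammingDist θ (Function.update θ b false) : ℝ) ≤ 1 := by
        exact_mod_cast hammingDist_update_le_one θ b false
      nlinarith) (fun θ θ' => extendZero_eq_or P _ _)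
    (fun θ => symTensor_mem_sparseTensors_of_support hH _ P hP
      fun p hp l => extendZero_of_notMem P _ hp l) est
  have he : (n : ℝ) ^ 2 / m ^ 2 * x * Fintype.card (P × Fin L) / 1280 =
      Real.log 2 * (P.card * L) / 6144000 := by
    rw [hx]
    simp only [Fintype.card_prod, Fintype.card_coe, Fintype.card_fin, Nat.cast_mul]
    field_simp
    norm_num
  simpa only [he] using h

end DSBM

/-! ### Connectivity hypotheses with sparse transform coefficients -/

namespace DSBM

variable {m n L s n₀ : ℕ}

/-- The indicator vector of an optional element. -/
def optionIndicator {β : ℕ} (a : Option (Fin β)) (x : Fin β) : ℝ := if a = some x then 1 else 0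

lemma sum_optionIndicator_le {β : ℕ} (a : Option (Fin β)) : ∑ x, optionIndicator a x ≤ 1 := by
  cases a <;> simp [optionIndicator]

lemma sum_sq_optionIndicator_none_le {β : ℕ} (a : Option (Fin β)) :
    ∑ x, (optionIndicator a x - optionIndicator none x) ^ 2 ≤ 1 := by
  cases a <;> simp [optionIndicator]

lemma one_le_sum_sq_optionIndicator {β : ℕ} {a a' : Option (Fin β)} (h : a ≠ a') :
    1 ≤ ∑ x, (optionIndicator a x - optionIndicator a' x) ^ 2 := by
  have key : ∀ x, (a = some x ∧ a' ≠ some x) ∨ (a ≠ some x ∧ a' = some x) →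
      1 ≤ ∑ x, (optionIndicator a x - optionIndicator a' x) ^ 2 := by
    intro x hx
    refine le_trans ?_ (Finset.single_le_sum
      (f := fun x => (optionIndicator a x - optionIndicator a' x) ^ 2)
      (fun _ _ => sq_nonneg _) (Finset.mem_univ x))
    rcases hx with ⟨h1, h2⟩ | ⟨h1, h2⟩ <;> simp [optionIndicator, h1, h2]
  rcases a with _ | x
  · rcases a' with _ | x
    · exact absurd rfl h
    · exact key x (Or.inr ⟨h, rfl⟩)
  · exact key x (Or.inl ⟨rfl, h.symm⟩)

/-- The position of the `x`-th coefficient of a block; the coefficient `0` belongs to no block. -/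
def coeffPosition {t β : ℕ} (h : t * β + 1 ≤ L) (y : Fin t × Fin β) : Fin L :=
  ⟨finProdFinEquiv y + 1, by
    have := (finProdFinEquiv y).2
    omega⟩

lemma coeffPosition_injective {t β : ℕ} (h : t * β + 1 ≤ L) :
    Function.Injective (coeffPosition h) := by
  intro y y' he
  simp only [coeffPosition, Fin.mk.injEq, Nat.add_right_cancel_iff] at he
  exact finProdFinEquiv.injective (Fin.ext he)

/-- The coefficient vector with one unit coefficient in each block where one is chosen. -/
noncomputable def coeffs {t β : ℕ} (h : t * β + 1 ≤ L) (θ : Fin t → Option (Fin β)) : Fin L → ℝ :=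
  Function.extend (coeffPosition h) (fun y => optionIndicator (θ y.1) y.2) fun _ => 0

lemma coeffs_position {t β : ℕ} (h : t * β + 1 ≤ L) (θ : Fin t → Option (Fin β))
    (y : Fin t × Fin β) : coeffs h θ (coeffPosition h y) = optionIndicator (θ y.1) y.2 :=
  (coeffPosition_injective h).extend_apply _ _ _

lemma coeffs_eq_zero {t β : ℕ} (h : t * β + 1 ≤ L) (θ : Fin t → Option (Fin β)) {l : Fin L}
    (hl : l ∉ Set.range (coeffPosition h)) : coeffs h θ l = 0 :=
  Function.extend_apply' _ _ _ hl

lemma coeffs_nonneg {t β : ℕ} (h : t * β + 1 ≤ L) (θ : Fin t → Option (Fin β)) (l : Fin L) :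
    0 ≤ coeffs h θ l := by
  by_cases hl : l ∈ Set.range (coeffPosition h)
  · obtain ⟨y, rfl⟩ := hl
    rw [coeffs_position, optionIndicator]
    split_ifs <;> norm_num
  · rw [coeffs_eq_zero h θ hl]

lemma sum_eq_sum_coeffPosition {t β : ℕ} (h : t * β + 1 ≤ L) (F : Fin L → ℝ)
    (hF : ∀ l ∉ Set.range (coeffPosition h), F l = 0) :
    ∑ l, F l = ∑ τ, ∑ x, F (coeffPosition h (τ, x)) := by
  rw [← Fintype.sum_prod_type']
  exact (Finset.sum_of_injOn (coeffPosition h) (coeffPosition_injective h).injOn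
    (fun _ _ => Finset.mem_coe.2 (Finset.mem_univ _)) (fun l _ hl => hF l (by simpa using hl))
    fun _ _ => rfl).symm

lemma sum_coeffs_le {t β : ℕ} (h : t * β + 1 ≤ L) (θ : Fin t → Option (Fin β)) :
    ∑ l, coeffs h θ l ≤ t := by
  rw [sum_eq_sum_coeffPosition h _ fun l hl => coeffs_eq_zero h θ hl]
  simp only [coeffs_position]
  exact (Finset.sum_le_sum fun τ _ => sum_optionIndicator_le (θ τ)).trans (by simp)

lemma sum_sq_coeffs_sub {t β : ℕ} (h : t * β + 1 ≤ L) (θ θ' : Fin t → Option (Fin β)) :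
    ∑ l, (coeffs h θ l - coeffs h θ' l) ^ 2 =
      ∑ τ, ∑ x, (optionIndicator (θ τ) x - optionIndicator (θ' τ) x) ^ 2 := by
  rw [sum_eq_sum_coeffPosition h _ fun l hl => by
    rw [coeffs_eq_zero h θ hl, coeffs_eq_zero h θ' hl]
    norm_num]
  simp only [coeffs_position]

/-- The lower bound for connectivities with sparse coefficients. -/
theorem exists_quarter_le_law_sparse (hm : 0 < m) (hn : 2 * m ≤ n)
    {H : Matrix (Fin L) (Fin L) ℝ} (hH : H ∈ Matrix.orthogonalGroup (Fin L) ℝ)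
    (hT : TransformCondition H) {P : Finset (ClassPair m)} (hP0 : P.Nonempty)
    {t β : ℕ} (ht : 0 < t) (hβ : 0 < β) (hL : t * β + 1 ≤ L) (hP : P.card * (t + 1) ≤ s)
    {ε : ℝ} (hε : 0 ≤ ε) (hε1 : t * ε ≤ √(L : ℝ) / 4)
    (hε2 : 4800 * n ^ 2 * ε ^ 2 ≤ m ^ 2 * Real.log (β + 1 : ℕ))
    (est : Observation n L → Fin n → Fin n → Fin L → ℝ) :
    ∃ G ∈ sparseTensors m L s H, ∃ z ∈ clusterings m n n₀ L, (1 / 4 : ℝ≥0∞) ≤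
      law (connProb G z) {a | n ^ 2 / m ^ 2 * ε ^ 2 * (P.card * t) / 1280 ≤
        sqDist (est a) (connProb G z)} := by
  classical
  have hL0 : 0 < L := by omega
  have hsL : 0 < √(L : ℝ) := Real.sqrt_pos.2 (by exact_mod_cast hL0)
  -- At most `t` coefficients equal `ε`, and the entries of `H` are at most `1 / √L`, so the
  -- perturbation stays below `t ε / √L ≤ 1 / 4`.
  have hsmall : ∀ (θ : Fin t → Option (Fin β)) l, |∑ l', H l' l * (ε * coeffs hL θ l')| ≤ 1 / 4 := by
    intro θ l
    calc |∑ l', H l' l * (ε * coeffs hL θ l')|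
        ≤ ∑ l', |H l' l * (ε * coeffs hL θ l')| := Finset.abs_sum_le_sum_abs _ _
      _ ≤ ∑ l', 1 / √(L : ℝ) * (ε * coeffs hL θ l') := Finset.sum_le_sum fun l' _ => by
          have h0 := mul_nonneg hε (coeffs_nonneg hL θ l')
          rw [abs_mul, abs_of_nonneg h0]
          exact mul_le_mul_of_nonneg_right (hT.abs_le l' l) h0
      _ = 1 / √(L : ℝ) * (ε * ∑ l', coeffs hL θ l') := by
          rw [← Finset.mul_sum, ← Finset.mul_sum]
      _ ≤ 1 / √(L : ℝ) * (ε * t) := by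
          have := sum_coeffs_le hL θ
          gcongr
      _ ≤ 1 / 4 := by
          rw [div_mul_eq_mul_div, div_le_iff₀ hsL]
          linarith
  let q : (P × Fin t → Option (Fin β)) → P → Fin L → Set.Icc (1 / 4 : ℝ) (3 / 4) := fun θ p l =>
    ⟨1 / 2 + ∑ l', H l' l * (ε * coeffs hL (fun τ => θ (p, τ)) l'), by
      have := abs_le.1 (hsmall (fun τ => θ (p, τ)) l)
      constructor <;> linarith⟩
  have hdist : ∀ θ θ', ∑ p, ∑ l, ((q θ p l : ℝ) - q θ' p l) ^ 2 =
      ε ^ 2 * ∑ b, ∑ x, (optionIndicator (θ b) x - optionIndicator (θ' b) x) ^ 2 := by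
    intro θ θ'
    rw [Fintype.sum_prod_type, Finset.mul_sum]
    refine Finset.sum_congr rfl fun p _ => ?_
    rw [← sum_sq_coeffs_sub hL (fun τ => θ (p, τ)) (fun τ => θ' (p, τ)), Finset.mul_sum]
    -- Orthogonality carries distances of coefficient vectors over to distances of connectivities
    -- without loss.
    have h1 := sum_sq_sum_mul hH (fun l' => ε * coeffs hL (fun τ => θ (p, τ)) l' -
      ε * coeffs hL (fun τ => θ' (p, τ)) l')
    simp only [mul_sub, Finset.sum_sub_distrib] at h1
    simp only [q, add_sub_add_left_eq_sub]
    rw [h1]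
    exact Finset.sum_congr rfl fun l _ => by ring
  have hmem : ∀ θ, symTensor (extendZero P (q θ)) ∈ sparseTensors m L s H := by
    intro θ
    -- A map whose image covers the support: for each class pair, one coefficient `0` for the
    -- baseline `1 / 2` and one for each block, whence `t + 1`. Blocks without a choice are sent to
    -- the coefficient `0` as a dummy.
    let pos : P × Option (Fin t) → Fin L × ClassPair m := fun y =>
      (match y.2 with
        | none => ⟨0, hL0⟩
        | some τ => match θ (y.1, τ) with
          | none => ⟨0, hL0⟩
          | some x => coeffPosition hL (τ, x), y.1)
    refine symTensor_mem_sparseTensors (fun x => if h : x.2 ∈ P then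
      (if x.1 = ⟨0, hL0⟩ then √(L : ℝ) / 2 else 0) +
        ε * coeffs hL (fun τ => θ (⟨x.2, h⟩, τ)) x.1 else 0) (fun p l => ?_) ?_
    · by_cases hp : p ∈ P
      · refine (extendZero_coe P (q θ) ⟨p, hp⟩ l).trans ?_
        simp only [hp, dif_pos, q, mul_add, Finset.sum_add_distrib,
          mul_ite, mul_zero, Finset.sum_ite_eq', Finset.mem_univ, if_true]
        have := hT.zero_apply hL0 hH l
        congr 1
        linarith
      · rw [extendZero_of_notMem P _ hp]
        simp [hp]
    · have hcard : (Set.univ : Set (P × Option (Fin t))).ncard = P.card * (t + 1) := by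
        rw [Set.ncard_univ, Nat.card_eq_fintype_card]
        simp
      refine le_trans ?_ (hcard.le.trans hP)
      refine le_trans (Set.ncard_le_ncard (t := pos '' Set.univ) ?_ (Set.toFinite _))
        (Set.ncard_image_le (Set.toFinite _))
      rintro ⟨l, p⟩ hx
      by_cases hp : p ∈ P
      · by_cases hl : l = ⟨0, hL0⟩
        · exact ⟨(⟨p, hp⟩, none), Set.mem_univ _, by simp [pos, hl]⟩
        · by_cases hr : l ∈ Set.range (coeffPosition hL)
          · obtain ⟨⟨τ, x⟩, rfl⟩ := hr
            have hθ : θ (⟨p, hp⟩, τ) = some x := by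
              by_contra hne
              exact hx (by simp [hp, hl, coeffs_position, optionIndicator, hne])
            exact ⟨(⟨p, hp⟩, some τ), Set.mem_univ _, by simp [pos, hθ]⟩
          · exact absurd (by simp [hp, hl, coeffs_eq_zero hL _ hr]) hx
      · exact absurd (by simp [hp]) hx
  have : Nonempty (P × Fin t) := ⟨(⟨_, hP0.choose_spec⟩, ⟨0, ht⟩)⟩
  have h := exists_quarter_le_law_connectivity (n₀ := n₀) hm hn (A := Option (Fin β))
    (B := P × Fin t) (by simpa using Nat.succ_le_of_lt hβ) none (fun θ => extendZero P (q θ)) (sq_nonneg ε)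
    (by simpa using hε2) (fun θ θ' => by
      rw [sum_extendZero, hdist]
      refine mul_le_mul_of_nonneg_left ?_ (sq_nonneg ε)
      rw [hammingDist, Finset.card_filter, Nat.cast_sum]
      refine Finset.sum_le_sum fun b _ => ?_
      split_ifs with hb
      · simpa using one_le_sum_sq_optionIndicator hb
      · simpa using Finset.sum_nonneg fun _ _ => sq_nonneg _) (fun θ b => by
      rw [sum_extendZero, hdist]
      refine mul_le_of_le_one_right (sq_nonneg ε) ?_
      rw [Finset.sum_eq_single b]
      · rw [Function.update_self]
        exact sum_sq_optionIndicator_none_le _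
      · intro b' _ hb'
        rw [Function.update_of_ne hb']
        simp
      · simp) (fun θ θ' => extendZero_eq_or P _ _) hmem est
  simpa only [Fintype.card_prod, Fintype.card_coe, Fintype.card_fin, Nat.cast_mul] using h

end DSBM

/-! ### The three terms of the rate and their combination -/

namespace DSBM

lemma law_mono_of_le {n L : ℕ} (hn : 0 < n) (hL : 0 < L) {Lam : ProbTensor n L}
    {est : Observation n L → Fin n → Fin n → Fin L → ℝ} {R T : ℝ} {w : ℝ≥0∞}
    (h : T * ((n : ℝ) ^ 2 * L) ≤ R) (hw : w ≤ law Lam {a | R ≤ sqDist (est a) Lam}) :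
    w ≤ law Lam {a | T ≤ sqDist (est a) Lam / ((n : ℝ) ^ 2 * L)} := by
  refine hw.trans (measure_mono fun a ha => ?_)
  have : (0 : ℝ) < (n : ℝ) ^ 2 * L := by positivity
  exact (le_div_iff₀ this).2 (h.trans ha)

/-- The factor by which logarithms grow under multiplication of the argument by `48 / γ`. -/
noncomputable def logFactor (γ : ℝ) : ℝ := 1 + Real.log (48 / γ) / Real.log 2

lemma one_le_logFactor {γ : ℝ} (hγ : 0 < γ) (hγ1 : γ ≤ 1 / 2) : 1 ≤ logFactor γ := by
  have h1 : 1 ≤ 48 / γ := by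
    rw [le_div_iff₀ hγ]
    linarith
  have := div_nonneg (Real.log_nonneg h1) (Real.log_nonneg one_le_two)
  unfold logFactor
  linarith

/-- Since `N ≥ 2`, the additive constant `log (48 / γ)` is absorbed as a multiple of `log N`. This
converts the logarithms of alphabet sizes into those of the rate. -/
lemma log_le_logFactor_mul {γ x : ℝ} (hγ : 0 < γ) (hγ1 : γ ≤ 1 / 2) {N : ℕ} (hN : 2 ≤ N)
    (hx : 0 < x) (h : γ * x ≤ 48 * N) : Real.log x ≤ logFactor γ * Real.log N := by
  have hN' : (2 : ℝ) ≤ N := by exact_mod_cast hN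
  have h1 : 1 ≤ 48 / γ := by
    rw [le_div_iff₀ hγ]
    linarith
  have h2 : x ≤ 48 / γ * N := by
    rw [div_mul_eq_mul_div, le_div_iff₀ hγ]
    linarith
  have h3 := Real.log_le_log hx h2
  rw [Real.log_mul (by linarith) (by linarith)] at h3
  have h4 : Real.log (48 / γ) ≤ Real.log (48 / γ) / Real.log 2 * Real.log N := by
    rw [div_mul_eq_mul_div, le_div_iff₀ (Real.log_pos one_lt_two)]
    exact mul_le_mul_of_nonneg_left (Real.log_le_log two_pos hN') (Real.log_nonneg h1)
  unfold logFactor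
  linarith

section Terms

variable {γ : ℝ} {m n L n₀ s : ℕ} {H : Matrix (Fin L) (Fin L) ℝ}

theorem exists_quarter_le_law_log_classes (hγ : 0 < γ) (hγ1 : γ ≤ 1 / 2)
    (hH : H ∈ Matrix.orthogonalGroup (Fin L) ℝ) (hT : TransformCondition H) (hm : 2 ≤ m)
    (hs : 2 ≤ s) (hms : ¬ (m = 2 ∧ s = 2)) (hγs : γ * (m : ℝ) ^ 2 ≤ s) (hL : 0 < L)
    (hn : 2 * m ≤ n) (est : Observation n L → Fin n → Fin n → Fin L → ℝ) :
    ∃ G ∈ sparseTensors m L s H, ∃ z ∈ clusterings m n n₀ L, (1 / 4 : ℝ≥0∞) ≤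
      law (connProb G z) {a | 1 / (2304000 * logFactor γ) * (Real.log m / (n * L)) ≤
        sqDist (est a) (connProb G z) / ((n : ℝ) ^ 2 * L)} := by
  obtain ⟨K, hK, hKm, P, hP⟩ := Pattern.exists_of_sparsity hγ hγ1 hm hs hms hγs hn
  obtain ⟨G, hG, z, hz, h⟩ := P.exists_quarter_le_law_const (n₀ := n₀) hn (by omega) hL hK hH hT hP
    est
  refine ⟨G, hG, z, hz, law_mono_of_le (by omega) hL ?_ h⟩
  have hm0 : (0 : ℝ) < m := by exact_mod_cast (by omega : 0 < m)
  have hn0 : (0 : ℝ) < n := by exact_mod_cast (by omega : 0 < n)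
  have hL0 : (0 : ℝ) < L := by exact_mod_cast hL
  have hA := one_le_logFactor hγ hγ1
  have h1 : Real.log m ≤ logFactor γ * Real.log (K + 1 : ℕ) :=
    log_le_logFactor_mul hγ hγ1 (by omega) hm0 (by
      push_cast
      linarith [Nat.cast_nonneg (α := ℝ) K])
  -- Rounding is harmless because `n ≥ 2 * m ≥ 4`.
  have h2 : (n : ℝ) ≤ 3 * (n / 2 : ℕ) := by exact_mod_cast (by omega : n ≤ 3 * (n / 2))
  have h3 : 0 ≤ Real.log (K + 1 : ℕ) := Real.log_natCast_nonneg _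
  calc 1 / (2304000 * logFactor γ) * (Real.log m / (n * L)) * ((n : ℝ) ^ 2 * L)
      = Real.log m * n / (2304000 * logFactor γ) := by field_simp
    _ ≤ (logFactor γ * Real.log (K + 1 : ℕ)) * (3 * (n / 2 : ℕ)) / (2304000 * logFactor γ) := by
        gcongr
    _ = Real.log (K + 1 : ℕ) * (n / 2 : ℕ) / 768000 := by
        field_simp
        ring

theorem exists_quarter_le_law_class_changes (hγ : 0 < γ) (hγ1 : γ ≤ 1 / 2)
    (hH : H ∈ Matrix.orthogonalGroup (Fin L) ℝ) (hT : TransformCondition H) (hm : 2 ≤ m)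
    (hs : 2 ≤ s) (hms : ¬ (m = 2 ∧ s = 2)) (hγs : γ * (m : ℝ) ^ 2 ≤ s) (hL : 0 < L)
    (hn : 2 * m ≤ n) (hn₀ : 1 ≤ n₀) (hn₀n : n₀ ≤ n / 2)
    (est : Observation n L → Fin n → Fin n → Fin L → ℝ) :
    ∃ G ∈ sparseTensors m L s H, ∃ z ∈ clusterings m n n₀ L, (1 / 4 : ℝ≥0∞) ≤
      law (connProb G z) {a | 1 / (1536000 * logFactor γ) *
        ((n₀ : ℝ) / (n : ℝ) ^ 2 * Real.log (m * n * Real.exp 1 / n₀)) ≤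
        sqDist (est a) (connProb G z) / ((n : ℝ) ^ 2 * L)} := by
  obtain ⟨K, hK, hKm, P, hP⟩ := Pattern.exists_of_sparsity hγ hγ1 hm hs hms hγs hn
  obtain ⟨G, hG, z, hz, h⟩ := P.exists_quarter_le_law_moved (n₀ := n₀) hn (by omega) hL hK hn₀ hn₀n
    hH hT hP est
  refine ⟨G, hG, z, hz, law_mono_of_le (by omega) hL ?_ h⟩
  set β := n / 2 / n₀ with hβ
  have hβ1 : 1 ≤ β := Nat.div_pos hn₀n hn₀
  have hm0 : (0 : ℝ) < m := by exact_mod_cast (by omega : 0 < m)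
  have hn0 : (0 : ℝ) < n := by exact_mod_cast (by omega : 0 < n)
  have hn₀0 : (0 : ℝ) < n₀ := by exact_mod_cast hn₀
  have hL0 : (0 : ℝ) < L := by exact_mod_cast hL
  have hK0 : (1 : ℝ) ≤ K := by exact_mod_cast hK
  have hA := one_le_logFactor hγ hγ1
  have hnβ : (n : ℝ) ≤ 4 * (n₀ * β) := by
    have h1 := Nat.lt_mul_div_succ (n / 2) (by omega : 0 < n₀)
    rw [← hβ] at h1
    have h2 : n₀ * (β + 1) ≤ 2 * (n₀ * β) := by nlinarith
    have h3 : n ≤ 4 * (n₀ * β) := by omega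
    exact_mod_cast h3
  -- Here `48 = 4 * 4 * 3` arises, from `γ m ≤ 2 (K + 1) ≤ 4 K`, `n ≤ 4 n₀ β` and `e ≤ 3`.
  have h1 : Real.log (m * n * Real.exp 1 / n₀) ≤ logFactor γ * Real.log (β * K + 1 : ℕ) := by
    refine log_le_logFactor_mul hγ hγ1 (by nlinarith) (by positivity) ?_
    rw [mul_div_assoc', div_le_iff₀ hn₀0]
    have he : Real.exp 1 ≤ 3 := by linarith [Real.exp_one_lt_d9]
    push_cast
    calc γ * (m * n * Real.exp 1) = (γ * m) * n * Real.exp 1 := by ring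
      _ ≤ (4 * K) * (4 * (n₀ * β)) * 3 :=
          mul_le_mul (mul_le_mul (by linarith) hnβ hn0.le (by positivity)) he
            (Real.exp_pos _).le (by positivity)
      _ = 48 * (β * K) * n₀ := by ring
      _ ≤ 48 * (β * K + 1) * n₀ := by
          gcongr
          linarith
  have h2 : (L : ℝ) * n₀ ≤ 2 * ((L + 1) / 2 * n₀ : ℕ) := by
    have : L * n₀ ≤ 2 * ((L + 1) / 2 * n₀) := by
      rw [← mul_assoc]
      exact Nat.mul_le_mul_right _ (by omega)
    exact_mod_cast this
  have h3 : 0 ≤ Real.log (β * K + 1 : ℕ) := Real.log_natCast_nonneg _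
  calc 1 / (1536000 * logFactor γ) * ((n₀ : ℝ) / (n : ℝ) ^ 2 *
        Real.log (m * n * Real.exp 1 / n₀)) * ((n : ℝ) ^ 2 * L)
      = Real.log (m * n * Real.exp 1 / n₀) * (L * n₀) / (1536000 * logFactor γ) := by
        generalize Real.log (m * n * Real.exp 1 / n₀) = x
        field_simp
    _ ≤ (logFactor γ * Real.log (β * K + 1 : ℕ)) * (2 * ((L + 1) / 2 * n₀ : ℕ)) /
        (1536000 * logFactor γ) := by
        gcongr
    _ = Real.log (β * K + 1 : ℕ) * ((L + 1) / 2 * n₀ : ℕ) / 768000 := by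
        field_simp
        ring

lemma card_classPair (m : ℕ) : 2 * Fintype.card (ClassPair m) = m * (m + 1) := by
  set S := (Finset.univ : Finset (Fin m × Fin m)).filter fun p => p.1 ≤ p.2 with hS
  set S' := (Finset.univ : Finset (Fin m × Fin m)).filter fun p => p.2 ≤ p.1 with hS'
  have h0 : Fintype.card (ClassPair m) = S.card := Fintype.card_subtype _
  have h1 : S.card = S'.card := Finset.card_equiv (Equiv.prodComm _ _) fun p => by simp [hS, hS']
  have h2 : S ∪ S' = Finset.univ := by
    ext p
    simp [hS, hS', le_total]
  have h3 : S ∩ S' = Finset.univ.diag := by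
    ext p
    simp [hS, hS', le_antisymm_iff]
  have h4 := Finset.card_union_add_card_inter S S'
  rw [h2, h3, ← h1, Finset.diag_card] at h4
  simp only [Finset.card_univ, Fintype.card_prod, Fintype.card_fin] at h4
  rw [h0, Nat.mul_add]
  omega

/-- The amplitude `ε` is chosen so that the perturbed probabilities stay in `[1 / 4, 3 / 4]`;
squaring shows that `19584 = 16 * 9 * 136` is what is needed. -/
lemma mul_sqrt_le_sqrt_div_four {γ m n L t s ℓ : ℝ} (hm : 0 < m) (hn : 0 < n) (hL : 0 ≤ L)
    (hℓ : 0 ≤ ℓ) (hγ : 0 ≤ γ) (ht : 0 ≤ t) (h1 : γ * m ^ 2 * t ≤ 3 * s)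
    (h2 : s ^ 2 * ℓ ≤ 136 * (L * (m ^ 2 * n ^ 2))) :
    t * √(γ ^ 2 / 19584 * (m ^ 2 / n ^ 2 * ℓ)) ≤ √L / 4 := by
  refine le_of_sq_le_sq ?_ (by positivity)
  rw [div_pow, Real.sq_sqrt hL, mul_pow, Real.sq_sqrt (by positivity)]
  have h3 : (γ * m ^ 2 * t) ^ 2 * ℓ ≤ (3 * s) ^ 2 * ℓ :=
    mul_le_mul_of_nonneg_right (pow_le_pow_left₀ (by positivity) h1 2) hℓ
  have h4 : t ^ 2 * (γ ^ 2 / 19584 * (m ^ 2 / n ^ 2 * ℓ)) =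
      (γ * m ^ 2 * t) ^ 2 * ℓ / (19584 * (m ^ 2 * n ^ 2)) := by
    field_simp
  rw [h4, div_le_iff₀ (by positivity)]
  linarith

theorem exists_quarter_le_law_sparsity_of_lt (hγ : 0 < γ) (hγ1 : γ ≤ 1 / 2)
    (hH : H ∈ Matrix.orthogonalGroup (Fin L) ℝ) (hT : TransformCondition H) (hm : 2 ≤ m)
    (hs : 2 ≤ s) (hL : 2 ≤ L) (hn : 2 * m ≤ n)
    (hsn : (s : ℝ) ^ 2 * Real.log (2 * L * ((m : ℝ) * (m + 1) / 2) / s) ≤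
      68 * L * ((m : ℝ) * (m + 1) / 2) * (n : ℝ) ^ 2)
    {P : Finset (ClassPair m)} (hP0 : 0 < P.card) (hPs : 2 * P.card ≤ s)
    (hPM : (P.card : ℝ) ≤ (m : ℝ) * (m + 1) / 2) (hPm : γ * (m : ℝ) ^ 2 ≤ 3 * P.card)
    (hsparse : s < L * P.card) (est : Observation n L → Fin n → Fin n → Fin L → ℝ) :
    ∃ G ∈ sparseTensors m L s H, ∃ z ∈ clusterings m n n₀ L, (1 / 4 : ℝ≥0∞) ≤
      law (connProb G z) {a | γ ^ 2 / (75202560 * logFactor γ) *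
        (s * Real.log (L * (m : ℝ) ^ 2 / s) / ((n : ℝ) ^ 2 * L)) ≤
        sqDist (est a) (connProb G z) / ((n : ℝ) ^ 2 * L)} := by
  have hm0 : (0 : ℝ) < m := by exact_mod_cast (by omega : 0 < m)
  have hn0 : (0 : ℝ) < n := by exact_mod_cast (by omega : 0 < n)
  have hL0 : (0 : ℝ) < L := by exact_mod_cast (by omega : 0 < L)
  have hs0 : (0 : ℝ) < s := by exact_mod_cast (by omega : 0 < s)
  have hm2 : (2 : ℝ) ≤ m := by exact_mod_cast hm
  have hP0' : (0 : ℝ) < P.card := by exact_mod_cast hP0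
  have hA := one_le_logFactor hγ hγ1
  have hM2 : (m : ℝ) * (m + 1) / 2 ≤ (m : ℝ) ^ 2 := by nlinarith
  generalize (m : ℝ) * (m + 1) / 2 = M at *
  have hM0 : 0 < M := hP0'.trans_le hPM
  -- Each class pair gets `s / P.card` coefficients, one of which is spent on the baseline.
  obtain ⟨t, ht⟩ : ∃ t, s / P.card = t + 1 := ⟨s / P.card - 1, by
    have : 0 < s / P.card := Nat.div_pos (by omega) hP0
    omega⟩
  have ht1 : 1 ≤ t := by
    have : 2 ≤ s / P.card := (Nat.le_div_iff_mul_le hP0).2 hPs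
    omega
  have htL : t + 1 < L := by
    rw [← ht]
    exact (Nat.div_lt_iff_lt_mul hP0).2 hsparse
  have hts : P.card * (t + 1) ≤ s := ht ▸ Nat.mul_div_le _ _
  have hst : s ≤ 3 * (P.card * t) := by
    have h1 := Nat.lt_mul_div_succ s hP0
    rw [ht] at h1
    nlinarith
  -- The coefficients other than `0` are split into `t` blocks of equal size `(L - 1) / t`.
  obtain ⟨β, hβ1, hβL, hLβ⟩ : ∃ β, 1 ≤ β ∧ t * β + 1 ≤ L ∧ L ≤ 2 * (t * (β + 1)) := by
    refine ⟨(L - 1) / t, Nat.div_pos (by omega) ht1, ?_, ?_⟩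
    · have := Nat.mul_div_le (L - 1) t
      omega
    · have := Nat.lt_mul_div_succ (L - 1) ht1
      omega
  have ht0 : (0 : ℝ) < t := by exact_mod_cast ht1
  have hts' : (P.card : ℝ) * t ≤ s := by
    exact_mod_cast (Nat.mul_le_mul_left _ (Nat.le_succ t)).trans hts
  have hst' : (s : ℝ) ≤ 3 * (P.card * t) := by exact_mod_cast hst
  have hβL' : (t : ℝ) * β ≤ L := by exact_mod_cast (by omega : t * β ≤ L)
  have hLβ' : (L : ℝ) ≤ 2 * (t * (β + 1)) := by exact_mod_cast hLβ
  have hsparse' : (s : ℝ) < L * P.card := by exact_mod_cast hsparse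
  have hlogN : 0 ≤ Real.log (β + 1 : ℕ) := Real.log_natCast_nonneg _
  have hlogX : Real.log (β + 1 : ℕ) ≤ 2 * Real.log (2 * L * M / s) := by
    have hX : 2 ≤ 2 * L * M / s := by
      rw [le_div_iff₀ hs0]
      linarith [mul_le_mul_of_nonneg_left hPM hL0.le]
    have h1 : (β : ℝ) ≤ 3 / 2 * (2 * L * M / s) := by
      rw [mul_div_assoc', le_div_iff₀ hs0]
      calc (β : ℝ) * s ≤ β * (3 * (P.card * t)) := by gcongr
        _ = 3 * P.card * (t * β) := by ring
        _ ≤ 3 * M * L := by gcongr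
        _ = _ := by ring
    -- With `X = 2 L M / s ≥ 2`, one has `β + 1 ≤ 3 X / 2 + 1 ≤ X²`. The resulting factor `2` turns
    -- the `68` of the hypothesis into `136`.
    have hNX : ((β + 1 : ℕ) : ℝ) ≤ (2 * L * M / s) ^ 2 := by
      push_cast
      linarith [mul_le_mul_of_nonneg_right hX (zero_le_two.trans hX)]
    have h2 := Real.log_le_log (by positivity) hNX
    rw [Real.log_pow] at h2
    exact_mod_cast h2
  have h1 : Real.log (L * (m : ℝ) ^ 2 / s) ≤ logFactor γ * Real.log (β + 1 : ℕ) := by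
    refine log_le_logFactor_mul hγ hγ1 (by omega) (by positivity) ?_
    rw [mul_div_assoc', div_le_iff₀ hs0]
    push_cast
    calc γ * ((L : ℝ) * (m : ℝ) ^ 2) = (L : ℝ) * (γ * (m : ℝ) ^ 2) := by ring
      _ ≤ 2 * ((t : ℝ) * (β + 1)) * (3 * P.card) := by gcongr
      _ = 6 * ((β : ℝ) + 1) * (P.card * t) := by ring
      _ ≤ 6 * ((β : ℝ) + 1) * s := by gcongr
      _ ≤ 48 * ((β : ℝ) + 1) * s := by gcongr; norm_num
  have htγ : γ * (m : ℝ) ^ 2 * t ≤ 3 * s := by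
    linarith [mul_le_mul_of_nonneg_right hPm ht0.le]
  have hs2 : (s : ℝ) ^ 2 * Real.log (β + 1 : ℕ) ≤ 136 * (L * ((m : ℝ) ^ 2 * (n : ℝ) ^ 2)) := by
    have h3 := mul_le_mul_of_nonneg_left hlogX (sq_nonneg (s : ℝ))
    have h4 : L * (n : ℝ) ^ 2 * M ≤ L * (n : ℝ) ^ 2 * (m : ℝ) ^ 2 :=
      mul_le_mul_of_nonneg_left hM2 (by positivity)
    linarith
  have hε := mul_sqrt_le_sqrt_div_four hm0 hn0 hL0.le hlogN hγ.le ht0.le htγ hs2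
  generalize Real.log (L * (m : ℝ) ^ 2 / s) = X at h1 ⊢
  generalize hℓ : Real.log (β + 1 : ℕ) = ℓ at *
  have hsq : √(γ ^ 2 / 19584 * (m ^ 2 / n ^ 2 * ℓ)) ^ 2 = γ ^ 2 / 19584 * (m ^ 2 / n ^ 2 * ℓ) :=
    Real.sq_sqrt (by positivity)
  obtain ⟨G, hG, z, hz, h⟩ := exists_quarter_le_law_sparse (n₀ := n₀) (by omega) hn hH hT
    (Finset.card_pos.1 hP0) ht1 hβ1 hβL hts (Real.sqrt_nonneg _) hε (by
      rw [hsq, hℓ]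
      have h1 : 4800 * (γ ^ 2 / 19584) ≤ 1 := by nlinarith
      calc 4800 * (n : ℝ) ^ 2 * (γ ^ 2 / 19584 * (m ^ 2 / n ^ 2 * ℓ))
          = 4800 * (γ ^ 2 / 19584) * (m ^ 2 * ℓ) := by field_simp
        _ ≤ 1 * (m ^ 2 * ℓ) := mul_le_mul_of_nonneg_right h1 (by positivity)
        _ = _ := one_mul _) est
  refine ⟨G, hG, z, hz, law_mono_of_le (by omega) (by omega) ?_ h⟩
  rw [hsq]
  calc γ ^ 2 / (75202560 * logFactor γ) * (s * X / ((n : ℝ) ^ 2 * L)) * ((n : ℝ) ^ 2 * L)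
      = γ ^ 2 / (75202560 * logFactor γ) * (s * X) := by field_simp
    _ ≤ γ ^ 2 / (75202560 * logFactor γ) * (s * (logFactor γ * ℓ)) := by gcongr
    _ = γ ^ 2 / 75202560 * ℓ * s := by field_simp
    _ ≤ γ ^ 2 / 75202560 * ℓ * (3 * (P.card * t)) := by gcongr
    _ = (n : ℝ) ^ 2 / m ^ 2 * (γ ^ 2 / 19584 * (m ^ 2 / n ^ 2 * ℓ)) * (P.card * t) / 1280 := by
        field_simp
        ring

theorem exists_quarter_le_law_sparsity (hγ : 0 < γ) (hγ1 : γ ≤ 1 / 2)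
    (hH : H ∈ Matrix.orthogonalGroup (Fin L) ℝ) (hT : TransformCondition H) (hm : 2 ≤ m)
    (hs : 2 ≤ s) (hγs : γ * (m : ℝ) ^ 2 ≤ s) (hL : 2 ≤ L) (hn : 2 * m ≤ n)
    (hsn : (s : ℝ) ^ 2 * Real.log (2 * L * ((m : ℝ) * (m + 1) / 2) / s) ≤
      68 * L * ((m : ℝ) * (m + 1) / 2) * (n : ℝ) ^ 2)
    (est : Observation n L → Fin n → Fin n → Fin L → ℝ) :
    ∃ G ∈ sparseTensors m L s H, ∃ z ∈ clusterings m n n₀ L, (1 / 4 : ℝ≥0∞) ≤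
      law (connProb G z) {a | γ ^ 2 / (75202560 * logFactor γ) *
        (s * Real.log (L * (m : ℝ) ^ 2 / s) / ((n : ℝ) ^ 2 * L)) ≤
        sqDist (est a) (connProb G z) / ((n : ℝ) ^ 2 * L)} := by
  have hm0 : (0 : ℝ) < m := by exact_mod_cast (by omega : 0 < m)
  have hn0 : (0 : ℝ) < n := by exact_mod_cast (by omega : 0 < n)
  have hL0 : (0 : ℝ) < L := by exact_mod_cast (by omega : 0 < L)
  have hs0 : (0 : ℝ) < s := by exact_mod_cast (by omega : 0 < s)
  have hm2 : (2 : ℝ) ≤ m := by exact_mod_cast hm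
  have hA := one_le_logFactor hγ hγ1
  set M : ℝ := (m : ℝ) * (m + 1) / 2 with hM
  have hMcard : (Fintype.card (ClassPair m) : ℝ) = M := by
    have : (2 : ℝ) * Fintype.card (ClassPair m) = m * (m + 1) := by
      exact_mod_cast card_classPair m
    rw [hM]
    linarith
  -- At most `s / 2` pairs, so that every pair has at least two coefficients: the baseline and one
  -- perturbation. The size is still of order `m²`, since `s ≥ γ m²`.
  obtain ⟨P, -, hP⟩ := Finset.exists_subset_card_eq
    (s := (Finset.univ : Finset (ClassPair m))) (n := min (Fintype.card (ClassPair m)) (s / 2))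
    (by rw [Finset.card_univ]; exact min_le_left _ _)
  have hPs : 2 * P.card ≤ s := by
    have : P.card ≤ s / 2 := hP ▸ min_le_right _ _
    omega
  have hPM : (P.card : ℝ) ≤ M := by
    rw [← hMcard]
    exact_mod_cast hP ▸ min_le_left _ _
  have hPm : γ * (m : ℝ) ^ 2 ≤ 3 * P.card := by
    rcases min_choice (Fintype.card (ClassPair m)) (s / 2) with h | h
    · rw [hP, h, hMcard, hM]
      nlinarith
    · have h1 : s ≤ 3 * P.card := by
        rw [hP, h]
        omega
      have h1' : (s : ℝ) ≤ 3 * P.card := by exact_mod_cast h1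
      linarith
  have hP0 : 0 < P.card := by
    have : (0 : ℝ) < P.card := by
      have : 0 < γ * (m : ℝ) ^ 2 := by positivity
      linarith
    exact_mod_cast this
  have hP0' : (0 : ℝ) < P.card := by exact_mod_cast hP0
  have hcancel : ∀ x : ℝ, γ ^ 2 / (75202560 * logFactor γ) * (x / ((n : ℝ) ^ 2 * L)) *
      ((n : ℝ) ^ 2 * L) = γ ^ 2 / (75202560 * logFactor γ) * x := fun x => by field_simp
  rcases le_or_gt (L * P.card) s with hdense | hsparse
  · obtain ⟨G, hG, z, hz, h⟩ := exists_quarter_le_law_dense (n₀ := n₀) (by omega) hn (by omega) hH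
      (Finset.card_pos.1 hP0) hdense est
    refine ⟨G, hG, z, hz, law_mono_of_le (by omega) (by omega) ?_ h⟩
    rw [hcancel]
    -- In the dense case `log x ≤ x` bounds the term by `L m²`, which is at most `3 L |P| / γ`, a
    -- multiple of the number of free bits.
    have h1 : s * Real.log (L * (m : ℝ) ^ 2 / s) ≤ L * (m : ℝ) ^ 2 := by
      have := Real.log_le_self (x := L * (m : ℝ) ^ 2 / s) (by positivity)
      rw [le_div_iff₀ hs0] at this
      linarith
    have h2 : 1 / 2 ≤ Real.log 2 := by linarith [Real.log_two_gt_d9]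
    calc γ ^ 2 / (75202560 * logFactor γ) * (s * Real.log (L * (m : ℝ) ^ 2 / s))
        ≤ γ ^ 2 / (75202560 * logFactor γ) * (L * (m : ℝ) ^ 2) := by gcongr
      _ ≤ γ ^ 2 / (75202560 * 1) * (L * (m : ℝ) ^ 2) := by gcongr
      _ = γ * (L * (γ * (m : ℝ) ^ 2)) / 75202560 := by ring
      _ ≤ 1 / 2 * (L * (3 * P.card)) / 75202560 := by gcongr
      _ ≤ 1 / 2 * (P.card * L) / 6144000 := by nlinarith [mul_pos hP0' hL0]
      _ ≤ Real.log 2 * (P.card * L) / 6144000 := by gcongr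
  · exact exists_quarter_le_law_sparsity_of_lt hγ hγ1 hH hT hm hs hL hn hsn hP0 hPs hPM hPm hsparse
      est

end Terms

/-- The minimax lower bound for a given value of `γ`. -/
theorem exists_const_quarter_le_law (γ : ℝ) : ∃ C : ℝ, 0 < C ∧ (0 < γ → γ ≤ 1 / 2 →
    ∀ (m n L n₀ s : ℕ) (H : Matrix (Fin L) (Fin L) ℝ), H ∈ Matrix.orthogonalGroup (Fin L) ℝ →
      TransformCondition H → 2 ≤ m → 2 ≤ s → ¬ (m = 2 ∧ s = 2) → γ * (m : ℝ) ^ 2 ≤ s →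
      2 ≤ L → 2 * m ≤ n → n₀ ≤ n / 2 →
      (s : ℝ) ^ 2 * Real.log (2 * L * ((m : ℝ) * (m + 1) / 2) / s) ≤
        68 * L * ((m : ℝ) * (m + 1) / 2) * (n : ℝ) ^ 2 →
      ∀ est : Observation n L → Fin n → Fin n → Fin L → ℝ,
        ∃ G ∈ sparseTensors m L s H, ∃ z ∈ clusterings m n n₀ L, (1 / 4 : ℝ≥0∞) ≤
          law (connProb G z) {a | C * rate m n L n₀ s ≤
            sqDist (est a) (connProb G z) / ((n : ℝ) ^ 2 * L)}) := by
  by_cases hγ : 0 < γ ∧ γ ≤ 1 / 2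
  swap
  · exact ⟨1, one_pos, fun h1 h2 => absurd ⟨h1, h2⟩ hγ⟩
  obtain ⟨hγ, hγ1⟩ := hγ
  have hA := one_le_logFactor hγ hγ1
  set c₁ := 1 / (2304000 * logFactor γ)
  set c₂ := 1 / (1536000 * logFactor γ)
  set c₃ := γ ^ 2 / (75202560 * logFactor γ)
  have hc₁ : 0 < c₁ := by positivity
  have hc₂ : 0 < c₂ := by positivity
  have hc₃ : 0 < c₃ := by positivity
  refine ⟨min c₁ (min c₂ c₃) / 3, by positivity, ?_⟩
  intro _ _ m n L n₀ s H hH hT hm hs hms hγs hL hn hn₀ hsn est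
  have hmono : ∀ {c T : ℝ}, min c₁ (min c₂ c₃) ≤ c → 0 ≤ T → rate m n L n₀ s ≤ 3 * T →
      (∃ G ∈ sparseTensors m L s H, ∃ z ∈ clusterings m n n₀ L, (1 / 4 : ℝ≥0∞) ≤
        law (connProb G z) {a | c * T ≤ sqDist (est a) (connProb G z) / ((n : ℝ) ^ 2 * L)}) →
      ∃ G ∈ sparseTensors m L s H, ∃ z ∈ clusterings m n n₀ L, (1 / 4 : ℝ≥0∞) ≤
        law (connProb G z) {a | min c₁ (min c₂ c₃) / 3 * rate m n L n₀ s ≤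
          sqDist (est a) (connProb G z) / ((n : ℝ) ^ 2 * L)} := by
    rintro c T hc hT0 hr ⟨G, hG, z, hz, h⟩
    refine ⟨G, hG, z, hz, h.trans (measure_mono fun a ha => ?_)⟩
    have h0 : 0 ≤ min c₁ (min c₂ c₃) := by positivity
    simp only [Set.mem_ofPred_eq] at ha ⊢
    refine le_trans ?_ ha
    calc min c₁ (min c₂ c₃) / 3 * rate m n L n₀ s ≤ min c₁ (min c₂ c₃) / 3 * (3 * T) := by gcongr
      _ = min c₁ (min c₂ c₃) * T := by ring
      _ ≤ c * T := by gcongr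
  set T₁ := Real.log m / (n * L) with hT₁
  set T₂ := (n₀ : ℝ) / (n : ℝ) ^ 2 * Real.log (m * n * Real.exp 1 / n₀) with hT₂
  set T₃ := s * Real.log (L * (m : ℝ) ^ 2 / s) / ((n : ℝ) ^ 2 * L) with hT₃
  have hrate : rate m n L n₀ s = T₁ + T₂ + T₃ := rfl
  -- The first term is positive, so the largest one is. In particular the second term is never
  -- selected when `n₀ = 0`, and a negative logarithm in the third does no harm.
  have hT₁0 : 0 < T₁ := by
    have h1 : 0 < Real.log m := Real.log_pos (by exact_mod_cast (by omega : 1 < m))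
    have h2 : (0 : ℝ) < n := by exact_mod_cast (by omega : 0 < n)
    have h3 : (0 : ℝ) < L := by exact_mod_cast (by omega : 0 < L)
    positivity
  by_cases h₁ : T₂ ≤ T₁ ∧ T₃ ≤ T₁
  · exact hmono (min_le_left _ _) hT₁0.le (by linarith)
      (exists_quarter_le_law_log_classes hγ hγ1 hH hT hm hs hms hγs (by omega) hn est)
  by_cases h₂ : T₃ ≤ T₂
  · have h21 : T₁ < T₂ := by
      by_contra h
      exact h₁ ⟨not_lt.1 h, h₂.trans (not_lt.1 h)⟩
    have hn₀1 : 1 ≤ n₀ := by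
      by_contra h
      obtain rfl : n₀ = 0 := by omega
      simp [hT₂] at h21
      linarith
    exact hmono ((min_le_right _ _).trans (min_le_left _ _)) (hT₁0.trans h21).le (by linarith)
      (exists_quarter_le_law_class_changes hγ hγ1 hH hT hm hs hms hγs (by omega) hn hn₀1 hn₀ est)
  · have h31 : T₁ < T₃ := by
      by_contra h
      exact h₁ ⟨(not_le.1 h₂).le.trans (not_lt.1 h), not_lt.1 h⟩
    exact hmono ((min_le_right _ _).trans (min_le_right _ _)) (hT₁0.trans h31).le (by linarith)
      (exists_quarter_le_law_sparsity hγ hγ1 hH hT hm hs hγs hL hn hsn est)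

end DSBM

theorem theorem3 :
    ∃ C : ℝ → ℝ, (∀ γ : ℝ, 0 < γ → 0 < C γ) ∧
      ∀ (κ : ℝ), 0 < κ →
      ∀ (m n L n₀ s : ℕ) (H : Matrix (Fin L) (Fin L) ℝ),
        H ∈ Matrix.orthogonalGroup (Fin L) ℝ →
        DSBM.TransformCondition H →
        2 ≤ m → 2 ≤ s → ¬ (m = 2 ∧ s = 2) →
        κ * (m : ℝ) ^ 2 ≤ s →
        2 ≤ L → 2 * m ≤ n →
        (n₀ : ℝ) ≤ min (min κ (1 / 2) * n)
          (4 / 3 * min κ (1 / 2) * n * (m : ℝ) ^ (-(1 / 9) : ℝ)) →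
        (s : ℝ) ^ 2 * Real.log (2 * L * ((m : ℝ) * (m + 1) / 2) / s) ≤
          68 * L * ((m : ℝ) * (m + 1) / 2) * (n : ℝ) ^ 2 →
        (1 / 4 : ℝ≥0∞) ≤
          ⨅ est : DSBM.Observation n L → Fin n → Fin n → Fin L → ℝ,
            ⨆ G ∈ DSBM.sparseTensors m L s H, ⨆ z ∈ DSBM.clusterings m n n₀ L,
              DSBM.law (DSBM.connProb G z)
                {a | C (min κ (1 / 2)) * DSBM.rate m n L n₀ s ≤
                  DSBM.sqDist (est a) (DSBM.connProb G z) / ((n : ℝ) ^ 2 * L)} := by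
  -- The range of `γ` is a premise inside the existential, so the constant is a function on all
  -- reals depending on `γ` alone.
  choose C hC hbound using DSBM.exists_const_quarter_le_law
  refine ⟨C, fun γ _ => hC γ, ?_⟩
  intro κ hκ m n L n₀ s H hH hT hm hs hms hκs hL hn hn₀ hsn
  refine le_iInf fun est => ?_
  have hγs : min κ (1 / 2) * (m : ℝ) ^ 2 ≤ s :=
    (mul_le_mul_of_nonneg_right (min_le_left _ _) (sq_nonneg _)).trans hκs
  have hn₀' : n₀ ≤ n / 2 := by
    have h1 : (n₀ : ℝ) ≤ 1 / 2 * n := (hn₀.trans (min_le_left _ _)).trans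
      (mul_le_mul_of_nonneg_right (min_le_right _ _) (Nat.cast_nonneg n))
    have h2 : (2 * n₀ : ℝ) ≤ n := by linarith
    have h3 : 2 * n₀ ≤ n := by exact_mod_cast h2
    omega
  obtain ⟨G, hG, z, hz, h⟩ := hbound (min κ (1 / 2)) (lt_min hκ (by norm_num)) (min_le_right _ _)
    m n L n₀ s H hH hT hm hs hms hγs hL hn hn₀' hsn est
  exact h.trans (le_iSup₂_of_le G hG (le_iSup₂_of_le z hz le_rfl))
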